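/- **Setting.** Conventions: $d\omega(X,Y)=\tfrac12\{X\omega(Y)-Y\omega(X)-\omega([X,Y])\}$, $(\alpha\wedge\beta)(X,Y)=\tfrac12\{\alpha(X)\beta(Y)-\alpha(Y)\beta(X)\}$, and $[A,A](X,Y)=A^2[X,Y]+[AX,AY]-A[AX,Y]-A[X,AY]$ for a $(1,1)$-tensor field $A$. Let $0<q<n$. An *indefinite complex contact manifold* $\overline M$ is a complex manifold of complex dimension $2n+1$, with complex structure $J$, together with the following data. 1. An open cover with holomorphic 1-forms $\theta$ on its members satisfying $\theta\wedge(d\theta)^n\neq0$ everywhere, any two of which differ on overlaps by a nonvanishing holomorphic factor. 2. A semi-Riemannian metric $\overline g$ of index $4q$ with $\overline g(JX,JY)=\overline g(X,Y)$. 3. An open cover with, on each of its members, a smooth 1-form $u$, a vector field $U$ and a $(1,1)$-tensor $G$ such that, with $v=u\circ J$, $V=-JU$, $H=GJ$, $$G^2=H^2=-I+u\otimes U+v\otimes V,\quad GJ=-JG,\quad GU=0,\quad u(U)=1,\quad \overline g(U,X)=u(X),\quad \overline g(GX,Y)=-\overline g(X,GY);$$ on overlaps $u'=au-bv$, $v'=bu+av$,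 $G'=aG-bH$, $H'=bG+aH$ for functions $a,b$ with $a^2+b^2=1$; $\theta$ equals $u-iv$ up to a nonvanishing complex-valued factor; and there is a smooth local 1-form $\sigma$ with $$du(X,Y)=\overline g(X,GY)+(\sigma\wedge v)(X,Y),\qquad dv(X,Y)=\overline g(X,HY)-(\sigma\wedge u)(X,Y).$$ It is *normal* if $S(X,Y)=T(X,Y)=0$ for all $X,Y$ with $u=v=0$ on them, and $S(U,X)=T(V,X)=0$ for all $X$, where $$S(X,Y)=[G,G](X,Y)+2\overline g(X,GY)U-2\overline g(X,HY)V+2\{v(Y)HX-v(X)HY\}+\sigma(GY)HX-\sigma(GX)HY+\sigma(X)GHY-\sigma(Y)GHX,$$ $$T(X,Y)=[H,H](X,Y)-2\overline g(X,GY)U+2\overline g(X,HY)V+2\{u(Y)GX-u(X)GY\}+\sigma(HX)GY-\sigma(HY)GX+\sigma(X)GHY-\sigma(Y)GHX.$$ Put $J_1=J$, $J_2=G$, $J_3=H$ ($J_2,J_3$ are local), and let $\overline\nabla$ be the Levi-Civita connection of $\overline g$. Let $M$ be an immersed submanifold of $\overline M$ that is $r$-null: $\mathrm{Rad}\,TM=TM\cap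 TM^\perp$ is a smooth distribution of rank $r>0$. Choose a smooth complement $S(TM)$ of $\mathrm{Rad}\,TM$ in $TM$, a smooth complement $S(TM^\perp)$ of $\mathrm{Rad}\,TM$ in $TM^\perp$, and a null transversal bundle $l\mathrm{tr}(TM)$, i.e. a totally null subbundle of $S(TM)^\perp\cap S(TM^\perp)^\perp$ locally spanned by sections $N_j$ with $\overline g(\xi_i,N_j)=\delta_{ij}$ for a local frame $(\xi_i)$ of $\mathrm{Rad}\,TM$. Then $T\overline M|_M=TM\oplus l\mathrm{tr}(TM)\oplus S(TM^\perp)$. For tangent fields $X,Y$, let $\nabla_XY$ be the $TM$-component of $\overline\nabla_XY$ (the induced connection), and for a section $W$ of $S(TM^\perp)$ let $\nabla^s_XW$ be the $S(TM^\perp)$-component of $\overline\nabla_XW$. Let $g$ be the metric induced on $M$; $\nabla$ is a *metric connection* if $\nabla g=0$. $M$ is *screen transversal anti-invariant* if $\mathrm{Span}\{U,V\}\subset S(TM^\perp)$ along $M$, $J_a\mathrm{Rad}\,TM\subset S(TM^\perp)$ and $J_aS(TM)\subset S(TM^\perp)$ for $a=1,2,3$. **Theorem.** Let $M$ be a screen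 transversal anti-invariant null submanifold of a normal indefinite complex contact manifold $\overline M$. Then, for each $a\in\{1,2,3\}$, the induced connection $\nabla$ is a metric connection if and only if, for all vector fields $X$ tangent to $M$ and all (local) sections $\xi$ of $\mathrm{Rad}\,TM$, $\nabla^s_XJ_a\xi$ has no component in $J_aS(TM)$, i.e. its component in $J_aS(TM)$ with respect to the orthogonal decomposition $S(TM^\perp)=J_aS(TM)\perp (J_aS(TM))^\perp$ vanishes. -/

import Mathlib

open Bundle Set VectorField
open scoped Manifold ContDiff Topology

noncomputable section

namespace NullGeom

/-! ## Semi-Riemannian geometry along an immersion -/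

section SemiRiemannian

variable {E : Type*} [NormedAddCommGroup E] [NormedSpace ℝ E]
  {N : Type*} [TopologicalSpace N] [ChartedSpace E N]
  {F : Type*} [NormedAddCommGroup F] [NormedSpace ℝ F]
  {M : Type*} [TopologicalSpace M] [ChartedSpace F M]

/-- The vector field `X` of `N` is smooth on the set `W`. -/
def SmoothFieldOn [IsManifold 𝓘(ℝ, E) ∞ N] (X : ∀ x : N, TangentSpace 𝓘(ℝ, E) x)
    (W : Set N) : Prop :=
  ContMDiffOn 𝓘(ℝ, E) (𝓘(ℝ, E).prod 𝓘(ℝ, E)) ∞ (fun x => (TotalSpace.mk' E x (X x))) W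

/-- The section `Y` of the pull-back `f^* TN` (a vector field along `f : M → N`) is smooth on the
set `W ⊆ M`. -/
def SmoothAlongOn [IsManifold 𝓘(ℝ, E) ∞ N] (f : M → N)
    (Y : ∀ p : M, TangentSpace 𝓘(ℝ, E) (f p)) (W : Set M) : Prop :=
  ContMDiffOn 𝓘(ℝ, F) (𝓘(ℝ, E).prod 𝓘(ℝ, E)) ∞
    (fun p => (⟨f p, Y p⟩ : TotalSpace E (TangentSpace 𝓘(ℝ, E) : N → Type _))) W

variable (E N) in
/-- A smooth semi-Riemannian metric on `N`. -/
structure SemiRiemannianMetric [IsManifold 𝓘(ℝ, E) ∞ N] where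
  val : ∀ x : N, TangentSpace 𝓘(ℝ, E) x →L[ℝ] TangentSpace 𝓘(ℝ, E) x →L[ℝ] ℝ
  symm : ∀ x v w, val x v w = val x w v
  nondegenerate : ∀ x v, (∀ w, val x v w = 0) → v = 0
  smooth : ContMDiff 𝓘(ℝ, E) (𝓘(ℝ, E).prod 𝓘(ℝ, E →L[ℝ] E →L[ℝ] ℝ)) ∞
    (fun x => TotalSpace.mk' (E →L[ℝ] E →L[ℝ] ℝ) x (val x))

namespace SemiRiemannianMetric

variable [IsManifold 𝓘(ℝ, E) ∞ N]

/-- The metric at `x` as a bilinear form on `T_x N`. -/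
def bilin (g : SemiRiemannianMetric E N) (x : N) :
    LinearMap.BilinForm ℝ (TangentSpace 𝓘(ℝ, E) x) :=
  LinearMap.mk₂ ℝ (fun v w => g.val x v w) (by simp) (by simp) (by simp) (by simp)

/-- The index of the metric at `x`: the maximal dimension of a negative definite subspace. -/
def index (g : SemiRiemannianMetric E N) (x : N) : ℕ :=
  sigNeg (g.bilin x).toQuadraticMap

/-- The orthogonal complement in `T_x N` of a subspace of `T_x N`. -/
def perp (g : SemiRiemannianMetric E N) {x : N} (D : Submodule ℝ (TangentSpace 𝓘(ℝ, E) x)) :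
    Submodule ℝ (TangentSpace 𝓘(ℝ, E) x) :=
  (g.bilin x).orthogonal D

theorem mem_perp (g : SemiRiemannianMetric E N) {x : N}
    {D : Submodule ℝ (TangentSpace 𝓘(ℝ, E) x)} {v : TangentSpace 𝓘(ℝ, E) x} :
    v ∈ g.perp D ↔ ∀ w ∈ D, g.val x w v = 0 := Iff.rfl

theorem perp_perp [FiniteDimensional ℝ E] (g : SemiRiemannianMetric E N) {x : N}
    (D : Submodule ℝ (TangentSpace 𝓘(ℝ, E) x)) : g.perp (g.perp D) = D := by
  have : FiniteDimensional ℝ (TangentSpace 𝓘(ℝ, E) x) := inferInstanceAs (FiniteDimensional ℝ E)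
  have hs : (g.bilin x).IsSymm := ⟨fun v w => g.symm x v w⟩
  have hr : (g.bilin x).IsRefl := hs.isRefl
  refine LinearMap.BilinForm.orthogonal_orthogonal ?_ hr D
  exact hr.nondegenerate_iff_separatingLeft.2 fun v hv => g.nondegenerate x v hv

/-- `D` is the Levi-Civita connection of `g`: the metric, torsion-free linear connection on `TN`. -/
structure IsLeviCivita (g : SemiRiemannianMetric E N)
    (D : CovariantDerivative 𝓘(ℝ, E) E (TangentSpace 𝓘(ℝ, E) : N → Type _)) : Prop where
  metric : ∀ (x : N) (Y Z : ∀ y : N, TangentSpace 𝓘(ℝ, E) y) (v : TangentSpace 𝓘(ℝ, E) x),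
    MDifferentiableAt 𝓘(ℝ, E) (𝓘(ℝ, E).prod 𝓘(ℝ, E)) (fun y => TotalSpace.mk' E y (Y y)) x →
    MDifferentiableAt 𝓘(ℝ, E) (𝓘(ℝ, E).prod 𝓘(ℝ, E)) (fun y => TotalSpace.mk' E y (Z y)) x →
    mvfderiv 𝓘(ℝ, E) (fun y => g.val y (Y y) (Z y)) x v =
      g.val x (D Y x v) (Z x) + g.val x (Y x) (D Z x v)
  torsion_free : ∀ (x : N) (X Y : ∀ y : N, TangentSpace 𝓘(ℝ, E) y),
    MDifferentiableAt 𝓘(ℝ, E) (𝓘(ℝ, E).prod 𝓘(ℝ, E)) (fun y => TotalSpace.mk' E y (X y)) x →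
    MDifferentiableAt 𝓘(ℝ, E) (𝓘(ℝ, E).prod 𝓘(ℝ, E)) (fun y => TotalSpace.mk' E y (Y y)) x →
    D Y x (X x) - D X x (Y x) = mlieBracket 𝓘(ℝ, E) X Y x

end SemiRiemannianMetric

/-- The pull-back `f^* D` of a connection `D` on `TN`, applied to a vector field `Y` along `f`:
`(∇_X Y)(p)` for `X ∈ T_p M`. If `(e_k)` is the frame of `TN` which is constant in the canonical
trivialization around `f p`, and `Y = ∑ Y^k (e_k ∘ f)`, this is
`∑ X(Y^k) e_k + D_{df X} (∑ Y^k(p) e_k)`. -/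
def pullbackConn [IsManifold 𝓘(ℝ, E) ∞ N]
    (D : CovariantDerivative 𝓘(ℝ, E) E (TangentSpace 𝓘(ℝ, E) : N → Type _)) (f : M → N)
    (Y : ∀ p : M, TangentSpace 𝓘(ℝ, E) (f p)) (p : M) (X : TangentSpace 𝓘(ℝ, F) p) :
    TangentSpace 𝓘(ℝ, E) (f p) :=
  (trivializationAt E (TangentSpace 𝓘(ℝ, E) : N → Type _) (f p)).symm (f p)
      (mvfderiv 𝓘(ℝ, F) (fun q =>
        (trivializationAt E (TangentSpace 𝓘(ℝ, E) : N → Type _) (f p) ⟨f q, Y q⟩).2) p X)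
    + D (FiberBundle.extend E (Y p)) (f p) (mfderiv 𝓘(ℝ, F) 𝓘(ℝ, E) f p X)

/-- The family `B p ⊆ T_{f p} N` is a smooth subbundle of `f^* TN` of rank `k`. -/
def IsSmoothSubbundle [IsManifold 𝓘(ℝ, E) ∞ N] (f : M → N)
    (B : ∀ p : M, Submodule ℝ (TangentSpace 𝓘(ℝ, E) (f p))) (k : ℕ) : Prop :=
  ∀ p : M, ∃ W : Set M, IsOpen W ∧ p ∈ W ∧
    ∃ e : Fin k → ∀ q : M, TangentSpace 𝓘(ℝ, E) (f q),
      (∀ j, SmoothAlongOn (F := F) f (e j) W) ∧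
      ∀ q ∈ W, LinearIndependent ℝ (fun j => e j q) ∧
        Submodule.span ℝ (Set.range fun j => e j q) = B q

/-- The tangent space `T_p M`, seen as the subspace `df(T_p M)` of `T_{f p} N`. -/
def tangentSub (F : Type*) [NormedAddCommGroup F] [NormedSpace ℝ F] [ChartedSpace F M]
    (f : M → N) (p : M) : Submodule ℝ (TangentSpace 𝓘(ℝ, E) (f p)) :=
  LinearMap.range (mfderiv 𝓘(ℝ, F) 𝓘(ℝ, E) f p).toLinearMap

variable [IsManifold 𝓘(ℝ, E) ∞ N]

/-- `Rad T_p M = T_p M ∩ T_p M^⊥`. -/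
def radSub (F : Type*) [NormedAddCommGroup F] [NormedSpace ℝ F] [ChartedSpace F M]
    (g : SemiRiemannianMetric E N) (f : M → N) (p : M) :
    Submodule ℝ (TangentSpace 𝓘(ℝ, E) (f p)) :=
  tangentSub F f p ⊓ g.perp (tangentSub F f p)

/-- `f : M → N` is an (immersed) `r`-null submanifold of `(N, g)`. -/
structure IsNullSubmanifold (F : Type*) [NormedAddCommGroup F] [NormedSpace ℝ F]
    [ChartedSpace F M] (g : SemiRiemannianMetric E N) (f : M → N) (r : ℕ) : Prop where
  smooth : ContMDiff 𝓘(ℝ, F) 𝓘(ℝ, E) ∞ f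
  injective : ∀ p, Function.Injective (mfderiv 𝓘(ℝ, F) 𝓘(ℝ, E) f p)
  rank_pos : 0 < r
  rad_smooth : IsSmoothSubbundle (F := F) f (radSub F g f) r

/-- The choices that accompany an `r`-null submanifold: a screen distribution `S(TM)`, a screen
transversal bundle `S(TM^⊥)` and a null transversal bundle `ltr(TM)`, all of them seen as subbundles
of `f^* TN`. That `S(TM)` and `S(TM^⊥)` are nondegenerate is automatic, as they are complementary to
the radical of `TM` and of `TM^⊥` respectively. -/
structure NullBundles (F : Type*) [NormedAddCommGroup F] [NormedSpace ℝ F]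
    [ChartedSpace F M] (g : SemiRiemannianMetric E N) (f : M → N) (r : ℕ) where
  /-- the screen distribution `S(TM)` -/
  screen : ∀ p : M, Submodule ℝ (TangentSpace 𝓘(ℝ, E) (f p))
  /-- the screen transversal bundle `S(TM^⊥)` -/
  screenTr : ∀ p : M, Submodule ℝ (TangentSpace 𝓘(ℝ, E) (f p))
  /-- the null transversal bundle `ltr(TM)` -/
  ltr : ∀ p : M, Submodule ℝ (TangentSpace 𝓘(ℝ, E) (f p))
  screen_smooth : ∃ k, IsSmoothSubbundle (F := F) f screen k
  screen_disjoint : ∀ p, radSub F g f p ⊓ screen p = ⊥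
  screen_sup : ∀ p, radSub F g f p ⊔ screen p = tangentSub F f p
  screenTr_smooth : ∃ k, IsSmoothSubbundle (F := F) f screenTr k
  screenTr_disjoint : ∀ p, radSub F g f p ⊓ screenTr p = ⊥
  screenTr_sup : ∀ p, radSub F g f p ⊔ screenTr p = g.perp (tangentSub F f p)
  /-- `ltr(TM)` lies in the orthogonal complement of `S(TM^⊥)` in `S(TM)^⊥` -/
  ltr_le : ∀ p, ltr p ≤ g.perp (screen p) ⊓ g.perp (screenTr p)
  ltr_null : ∀ p, ∀ v ∈ ltr p, ∀ w ∈ ltr p, g.val (f p) v w = 0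
  /-- `ltr(TM)` is locally spanned by sections `N_j` dual to a frame `ξ_i` of `Rad TM` -/
  ltr_frame : ∀ p : M, ∃ W : Set M, IsOpen W ∧ p ∈ W ∧
    ∃ ξ η : Fin r → ∀ q : M, TangentSpace 𝓘(ℝ, E) (f q),
      (∀ j, SmoothAlongOn (F := F) f (ξ j) W) ∧ (∀ j, SmoothAlongOn (F := F) f (η j) W) ∧
      ∀ q ∈ W, Submodule.span ℝ (Set.range fun j => ξ j q) = radSub F g f q ∧
        Submodule.span ℝ (Set.range fun j => η j q) = ltr q ∧
        ∀ i j, g.val (f q) (ξ i q) (η j q) = if i = j then 1 else 0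

namespace NullBundles

variable {g : SemiRiemannianMetric E N} {f : M → N} {r : ℕ}

/-- The transversal bundle `tr(TM) = ltr(TM) ⊥ S(TM^⊥)`. -/
def tr (B : NullBundles F g f r) (p : M) : Submodule ℝ (TangentSpace 𝓘(ℝ, E) (f p)) :=
  B.ltr p ⊔ B.screenTr p

theorem ltr_eq_zero (B : NullBundles F g f r) {p : M} {v : TangentSpace 𝓘(ℝ, E) (f p)}
    (hv : v ∈ B.ltr p) (h : ∀ w ∈ radSub F g f p, g.val (f p) w v = 0) : v = 0 := by
  obtain ⟨W, -, hp, ξ, η, -, -, H⟩ := B.ltr_frame p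
  obtain ⟨h1, h2, h3⟩ := H p hp
  rw [← h2] at hv
  obtain ⟨c, rfl⟩ := (Submodule.mem_span_range_iff_exists_fun ℝ).1 hv
  refine Finset.sum_eq_zero fun i _ => ?_
  have := h (ξ i p) (h1 ▸ Submodule.subset_span ⟨i, rfl⟩)
  simp [h3] at this
  simp [this]

theorem rad_eq_zero (B : NullBundles F g f r) {p : M} {v : TangentSpace 𝓘(ℝ, E) (f p)}
    (hv : v ∈ radSub F g f p) (h : ∀ w ∈ B.ltr p, g.val (f p) v w = 0) : v = 0 := by
  obtain ⟨W, -, hp, ξ, η, -, -, H⟩ := B.ltr_frame p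
  obtain ⟨h1, h2, h3⟩ := H p hp
  rw [← h1] at hv
  obtain ⟨c, rfl⟩ := (Submodule.mem_span_range_iff_exists_fun ℝ).1 hv
  refine Finset.sum_eq_zero fun i _ => ?_
  have := h (η i p) (h2 ▸ Submodule.subset_span ⟨i, rfl⟩)
  simp [h3] at this
  simp [this]

theorem screenTr_le (B : NullBundles F g f r) (p : M) :
    B.screenTr p ≤ g.perp (tangentSub F f p) := B.screenTr_sup p ▸ le_sup_right

theorem sum_eq_zero (B : NullBundles F g f r) {p : M} {t l s : TangentSpace 𝓘(ℝ, E) (f p)}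
    (ht : t ∈ tangentSub F f p) (hl : l ∈ B.ltr p) (hs : s ∈ B.screenTr p)
    (h : t + l + s = 0) : t = 0 ∧ l = 0 ∧ s = 0 := by
  have hs' := g.mem_perp.1 (B.screenTr_le p hs)
  have hl0 : l = 0 := by
    refine B.ltr_eq_zero hl fun w hw => ?_
    have h1 : g.val (f p) w (t + l + s) = 0 := by rw [h]; simp
    have h2 : g.val (f p) w t = 0 := by
      rw [g.symm]; exact g.mem_perp.1 hw.2 t ht
    have h3 : g.val (f p) w s = 0 := hs' w hw.1
    simpa [h2, h3] using h1
  subst hl0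
  have hts : s = -t := by
    rw [add_zero] at h
    exact (neg_eq_of_add_eq_zero_right h).symm
  have hsr : s ∈ radSub F g f p := by
    refine ⟨?_, B.screenTr_le p hs⟩
    rw [hts]; exact Submodule.neg_mem _ ht
  have : s ∈ radSub F g f p ⊓ B.screenTr p := ⟨hsr, hs⟩
  rw [B.screenTr_disjoint p, Submodule.mem_bot] at this
  refine ⟨?_, rfl, this⟩
  rw [this] at hts
  simpa using hts.symm

theorem sup_eq_top [FiniteDimensional ℝ E] (B : NullBundles F g f r) (p : M) :
    tangentSub F f p ⊔ B.tr p = ⊤ := by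
  rw [← g.perp_perp (tangentSub F f p ⊔ B.tr p), eq_top_iff]
  intro v _
  suffices hbot : ∀ w ∈ g.perp (tangentSub F f p ⊔ B.tr p), w = 0 by
    refine g.mem_perp.2 fun w hw => ?_
    rw [hbot w hw]; simp
  intro w hw
  have hw' := g.mem_perp.1 hw
  have hwT : w ∈ g.perp (tangentSub F f p) :=
    g.mem_perp.2 fun t ht => hw' t (Submodule.mem_sup_left ht)
  have hwl : ∀ l ∈ B.ltr p, g.val (f p) l w = 0 := fun l hl =>
    hw' l (Submodule.mem_sup_right (Submodule.mem_sup_left hl))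
  have hws : ∀ s ∈ B.screenTr p, g.val (f p) s w = 0 := fun s hs =>
    hw' s (Submodule.mem_sup_right (Submodule.mem_sup_right hs))
  have hwT' := hwT
  rw [← B.screenTr_sup p] at hwT'
  obtain ⟨a, ha, s, hs, rfl⟩ := Submodule.mem_sup.1 hwT'
  have ha0 : a = 0 := by
    refine B.rad_eq_zero ha fun l hl => ?_
    have h1 := hwl l hl
    have h2 : g.val (f p) s l = 0 := g.mem_perp.1 (B.ltr_le p hl).2 s hs
    rw [map_add, g.symm _ l s, h2, add_zero] at h1
    rw [g.symm]; exact h1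
  subst ha0
  rw [zero_add] at *
  have hsT : s ∈ g.perp (g.perp (tangentSub F f p)) := by
    refine g.mem_perp.2 fun w hw => ?_
    rw [← B.screenTr_sup p] at hw
    obtain ⟨a, ha, s', hs', rfl⟩ := Submodule.mem_sup.1 hw
    have h1 : g.val (f p) a s = 0 := g.mem_perp.1 hwT a ha.1
    simp [h1, hws s' hs']
  rw [g.perp_perp] at hsT
  have : s ∈ radSub F g f p ⊓ B.screenTr p := ⟨⟨hsT, hwT⟩, hs⟩
  rwa [B.screenTr_disjoint p, Submodule.mem_bot] at this

/-- `TN|_M = TM ⊕ tr(TM)`. -/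
theorem isCompl_tr [FiniteDimensional ℝ E] (B : NullBundles F g f r) (p : M) :
    IsCompl (tangentSub F f p) (B.tr p) := by
  refine ⟨?_, codisjoint_iff.2 (B.sup_eq_top p)⟩
  rw [Submodule.disjoint_def]
  intro v hv hv'
  obtain ⟨l, hl, s, hs, rfl⟩ := Submodule.mem_sup.1 hv'
  have := B.sum_eq_zero hv (Submodule.neg_mem _ hl) (Submodule.neg_mem _ hs) (by abel)
  exact this.1

/-- `TN|_M = S(TM^⊥) ⊕ (TM ⊕ ltr(TM))`. -/
theorem isCompl_screenTr [FiniteDimensional ℝ E] (B : NullBundles F g f r) (p : M) :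
    IsCompl (B.screenTr p) (tangentSub F f p ⊔ B.ltr p) := by
  refine ⟨?_, codisjoint_iff.2 ?_⟩
  · rw [Submodule.disjoint_def]
    intro v hv hv'
    obtain ⟨t, ht, l, hl, rfl⟩ := Submodule.mem_sup.1 hv'
    have := B.sum_eq_zero (Submodule.neg_mem _ ht) (Submodule.neg_mem _ hl) hv (by abel)
    exact this.2.2
  · rw [← B.sup_eq_top p, tr, sup_comm, sup_assoc]

variable [FiniteDimensional ℝ E]

/-- The induced connection `∇` on `M`: `∇_X Y` is the component in `TM`, along `tr(TM)`, of
`∇̄_X Y` (Gauss formula). -/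
def inducedConn (B : NullBundles F g f r) (hf : IsNullSubmanifold F g f r)
    (D : CovariantDerivative 𝓘(ℝ, E) E (TangentSpace 𝓘(ℝ, E) : N → Type _))
    (Y : ∀ p : M, TangentSpace 𝓘(ℝ, F) p) (p : M) (X : TangentSpace 𝓘(ℝ, F) p) :
    TangentSpace 𝓘(ℝ, F) p :=
  LinearMap.linearProjOfIsCompl (B.tr p) (mfderiv 𝓘(ℝ, F) 𝓘(ℝ, E) f p).toLinearMap
    (hf.injective p) (B.isCompl_tr p)
    (pullbackConn D f (fun q => mfderiv 𝓘(ℝ, F) 𝓘(ℝ, E) f q (Y q)) p X)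

/-- `∇^s_X W`, for a section `W` of `S(TM^⊥)`: the component in `S(TM^⊥)`, along
`TM ⊕ ltr(TM)`, of `∇̄_X W` (Weingarten formula). -/
def screenTrConn (B : NullBundles F g f r)
    (D : CovariantDerivative 𝓘(ℝ, E) E (TangentSpace 𝓘(ℝ, E) : N → Type _))
    (W : ∀ p : M, TangentSpace 𝓘(ℝ, E) (f p)) (p : M) (X : TangentSpace 𝓘(ℝ, F) p) :
    TangentSpace 𝓘(ℝ, E) (f p) :=
  ((B.screenTr p).projectionOnto (tangentSub F f p ⊔ B.ltr p) (B.isCompl_screenTr p)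
    (pullbackConn D f W p X) : B.screenTr p)

/-- The induced (null) metric `f^* g` on `M`. -/
def _root_.NullGeom.inducedMetric (F : Type*) [NormedAddCommGroup F] [NormedSpace ℝ F]
    [ChartedSpace F M] (g : SemiRiemannianMetric E N) (f : M → N) (p : M)
    (v w : TangentSpace 𝓘(ℝ, F) p) : ℝ :=
  g.val (f p) (mfderiv 𝓘(ℝ, F) 𝓘(ℝ, E) f p v) (mfderiv 𝓘(ℝ, F) 𝓘(ℝ, E) f p w)

/-- The induced connection is a metric connection: `∇` annihilates the induced metric. -/
def IsMetricConnection [IsManifold 𝓘(ℝ, F) ∞ M] (B : NullBundles F g f r)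
    (hf : IsNullSubmanifold F g f r)
    (D : CovariantDerivative 𝓘(ℝ, E) E (TangentSpace 𝓘(ℝ, E) : N → Type _)) : Prop :=
  ∀ W : Set M, IsOpen W → ∀ Y Z : ∀ p : M, TangentSpace 𝓘(ℝ, F) p,
    SmoothFieldOn Y W → SmoothFieldOn Z W → ∀ p ∈ W, ∀ X : TangentSpace 𝓘(ℝ, F) p,
      mvfderiv 𝓘(ℝ, F) (fun q => inducedMetric F g f q (Y q) (Z q)) p X
        - inducedMetric F g f p (B.inducedConn hf D Y p X) (Z p)
        - inducedMetric F g f p (Y p) (B.inducedConn hf D Z p X) = 0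

end NullBundles

/-- The exterior derivative of a 1-form, with the convention
`dω(X, Y) = ½ (X ω(Y) - Y ω(X) - ω([X, Y]))`. -/
def extDer {A : Type*} [NormedAddCommGroup A] [NormedSpace ℝ A]
    (α : ∀ x : N, TangentSpace 𝓘(ℝ, E) x →L[ℝ] A) (X Y : ∀ x : N, TangentSpace 𝓘(ℝ, E) x)
    (x : N) : A :=
  (2⁻¹ : ℝ) • (mvfderiv 𝓘(ℝ, E) (fun y => α y (Y y)) x (X x)
    - mvfderiv 𝓘(ℝ, E) (fun y => α y (X y)) x (Y x) - α x (mlieBracket 𝓘(ℝ, E) X Y x))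

/-- The wedge product of 1-forms, with the convention
`(α ∧ β)(v, w) = ½ (α(v) β(w) - α(w) β(v))`. -/
def wedge {x : N} (α β : TangentSpace 𝓘(ℝ, E) x →L[ℝ] ℝ) (v w : TangentSpace 𝓘(ℝ, E) x) : ℝ :=
  2⁻¹ * (α v * β w - α w * β v)

/-- The Nijenhuis tensor `[A, A](X, Y) = A²[X, Y] + [AX, AY] - A[AX, Y] - A[X, AY]` of a
(1,1)-tensor field. -/
def nijenhuis (A : ∀ x : N, TangentSpace 𝓘(ℝ, E) x →L[ℝ] TangentSpace 𝓘(ℝ, E) x)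
    (X Y : ∀ x : N, TangentSpace 𝓘(ℝ, E) x) (x : N) : TangentSpace 𝓘(ℝ, E) x :=
  A x (A x (mlieBracket 𝓘(ℝ, E) X Y x))
    + mlieBracket 𝓘(ℝ, E) (fun y => A y (X y)) (fun y => A y (Y y)) x
    - A x (mlieBracket 𝓘(ℝ, E) (fun y => A y (X y)) Y x)
    - A x (mlieBracket 𝓘(ℝ, E) X (fun y => A y (Y y)) x)

end SemiRiemannian

/-! ## Complex contact manifolds

A complex manifold `N` is modelled on a complex vector space `E`; the real tangent space is
`TangentSpace 𝓘(ℝ, E) x` (with underlying vector space `E`, identified by the preferred chart). -/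

section Complex

variable {E : Type*} [NormedAddCommGroup E] [NormedSpace ℂ E]
  {N : Type*} [TopologicalSpace N] [ChartedSpace E N]

/-- A complex manifold is a smooth real manifold. -/
instance isManifold_real [IsManifold 𝓘(ℂ, E) ω N] : IsManifold 𝓘(ℝ, E) ∞ N := by
  have : HasGroupoid N (contDiffGroupoid ω 𝓘(ℂ, E)) := inferInstance
  refine { compatible := ?_ }
  intro e e' he he'
  have h := HasGroupoid.compatible (G := contDiffGroupoid ω 𝓘(ℂ, E)) he he'
  rw [contDiffGroupoid, mem_groupoid_of_pregroupoid] at h ⊢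
  simp only [contDiffPregroupoid] at h ⊢
  exact ⟨(h.1.restrict_scalars ℝ).of_le (by simp), (h.2.restrict_scalars ℝ).of_le (by simp)⟩

/-- The almost complex structure `J` of a complex manifold: multiplication by `i` in
holomorphic charts. -/
def cplxJ (x : N) : TangentSpace 𝓘(ℝ, E) x →L[ℝ] TangentSpace 𝓘(ℝ, E) x :=
  ((Complex.I • ContinuousLinearMap.id ℂ E).restrictScalars ℝ : E →L[ℝ] E)

/-- A complex covector as a complex valued covector on the real tangent space. -/
def realCovector {x : N} (α : TangentSpace 𝓘(ℂ, E) x →L[ℂ] ℂ) :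
    TangentSpace 𝓘(ℝ, E) x →L[ℝ] ℂ :=
  let β : E →L[ℂ] ℂ := α
  (β.restrictScalars ℝ : E →L[ℝ] ℂ)

/-- The value, up to a nonzero constant factor, of `θ ∧ (dθ)^n` on `2n+1` vector fields:
the complete antisymmetrization of `θ ⊗ dθ ⊗ ⋯ ⊗ dθ`. -/
def contactVolume (n : ℕ) (θ : ∀ x : N, TangentSpace 𝓘(ℂ, E) x →L[ℂ] ℂ)
    (X : Fin (2 * n + 1) → ∀ x : N, TangentSpace 𝓘(ℝ, E) x) (x : N) : ℂ :=
  ∑ τ : Equiv.Perm (Fin (2 * n + 1)), ((Equiv.Perm.sign τ : ℤ) : ℂ) *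
    (realCovector (θ x) (X (τ 0) x) *
      ∏ j : Fin n, extDer (fun y => realCovector (θ y))
        (X (τ ⟨2 * j.1 + 1, by omega⟩)) (X (τ ⟨2 * j.1 + 2, by omega⟩)) x)

variable [IsManifold 𝓘(ℂ, E) ω N]

variable (E N) in
/-- A complex contact structure on a complex manifold `N` of complex dimension `2n+1`. -/
structure ComplexContactStructure (n : ℕ) (κ : Type*) where
  dim : Module.finrank ℂ E = 2 * n + 1
  O : κ → Set N
  isOpen : ∀ k, IsOpen (O k)
  cover : ∀ x, ∃ k, x ∈ O k
  /-- the local contact forms -/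
  θ : κ → ∀ x : N, TangentSpace 𝓘(ℂ, E) x →L[ℂ] ℂ
  holomorphic : ∀ k, ContMDiffOn 𝓘(ℂ, E) (𝓘(ℂ, E).prod 𝓘(ℂ, E →L[ℂ] ℂ)) ω
    (fun x => TotalSpace.mk' (E →L[ℂ] ℂ) x (θ k x)) (O k)
  /-- `θ ∧ (dθ)^n` vanishes nowhere -/
  contact : ∀ k, ∀ x ∈ O k, ∃ W ⊆ O k, IsOpen W ∧ x ∈ W ∧
    ∃ X : Fin (2 * n + 1) → ∀ x : N, TangentSpace 𝓘(ℝ, E) x,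
    (∀ j, SmoothFieldOn (X j) W) ∧ contactVolume n (θ k) X x ≠ 0
  /-- on overlaps the contact forms differ by a nonvanishing holomorphic function -/
  overlap : ∀ k l, ∃ φ : N → ℂ,
    ContMDiffOn 𝓘(ℂ, E) 𝓘(ℂ, ℂ) ω φ (O k ∩ O l) ∧
    ∀ x ∈ O k ∩ O l, φ x ≠ 0 ∧ θ k x = φ x • θ l x

/-- A complex almost contact metric structure on a complex manifold `N` with (semi-Riemannian)
Hermitian metric `g`. The local tensors `v = u ∘ J`, `V = -JU`, `H = GJ` are defined below;
`H² = G²` follows from `GJ = -JG`. -/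
structure ComplexAlmostContactMetric (g : SemiRiemannianMetric E N) (ι : Type*) where
  hermitian : ∀ x v w, g.val x (cplxJ x v) (cplxJ x w) = g.val x v w
  O : ι → Set N
  isOpen : ∀ i, IsOpen (O i)
  cover : ∀ x, ∃ i, x ∈ O i
  u : ι → ∀ x : N, TangentSpace 𝓘(ℝ, E) x →L[ℝ] ℝ
  U : ι → ∀ x : N, TangentSpace 𝓘(ℝ, E) x
  G : ι → ∀ x : N, TangentSpace 𝓘(ℝ, E) x →L[ℝ] TangentSpace 𝓘(ℝ, E) x
  u_smooth : ∀ i, ContMDiffOn 𝓘(ℝ, E) (𝓘(ℝ, E).prod 𝓘(ℝ, E →L[ℝ] ℝ)) ∞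
    (fun x => TotalSpace.mk' (E →L[ℝ] ℝ) x (u i x)) (O i)
  U_smooth : ∀ i, SmoothFieldOn (U i) (O i)
  G_smooth : ∀ i, ContMDiffOn 𝓘(ℝ, E) (𝓘(ℝ, E).prod 𝓘(ℝ, E →L[ℝ] E)) ∞
    (fun x => TotalSpace.mk' (E →L[ℝ] E) x (G i x)) (O i)
  u_U : ∀ i, ∀ x ∈ O i, u i x (U i x) = 1
  dual : ∀ i, ∀ x ∈ O i, ∀ w, g.val x (U i x) w = u i x w
  G_U : ∀ i, ∀ x ∈ O i, G i x (U i x) = 0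
  G_J : ∀ i, ∀ x ∈ O i, ∀ w, G i x (cplxJ x w) = - cplxJ x (G i x w)
  G_skew : ∀ i, ∀ x ∈ O i, ∀ w z, g.val x (G i x w) z = - g.val x w (G i x z)
  /-- `G² = -I + u ⊗ U + v ⊗ V` -/
  G_sq : ∀ i, ∀ x ∈ O i, ∀ w,
    G i x (G i x w) = -w + u i x w • U i x + u i x (cplxJ x w) • (- cplxJ x (U i x))
  /-- `u_j = a u_i - b v_i`, `v_j = b u_i + a v_i`, `G_j = a G_i - b H_i`, `H_j = b G_i + a H_i` -/
  overlap : ∀ i j, ∃ a b : N → ℝ, ∀ x ∈ O i ∩ O j, a x ^ 2 + b x ^ 2 = 1 ∧ ∀ w,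
    u j x w = a x * u i x w - b x * u i x (cplxJ x w) ∧
    u j x (cplxJ x w) = b x * u i x w + a x * u i x (cplxJ x w) ∧
    G j x w = a x • G i x w - b x • G i x (cplxJ x w) ∧
    G j x (cplxJ x w) = b x • G i x w + a x • G i x (cplxJ x w)

namespace ComplexAlmostContactMetric

variable {g : SemiRiemannianMetric E N} {ι : Type*}

/-- `v = u ∘ J` -/
def v (C : ComplexAlmostContactMetric g ι) (i : ι) (x : N) : TangentSpace 𝓘(ℝ, E) x →L[ℝ] ℝ :=
  (C.u i x).comp (cplxJ x)

/-- `V = -JU` -/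
def V (C : ComplexAlmostContactMetric g ι) (i : ι) (x : N) : TangentSpace 𝓘(ℝ, E) x :=
  - cplxJ x (C.U i x)

/-- `H = GJ` -/
def H (C : ComplexAlmostContactMetric g ι) (i : ι) (x : N) :
    TangentSpace 𝓘(ℝ, E) x →L[ℝ] TangentSpace 𝓘(ℝ, E) x :=
  (C.G i x).comp (cplxJ x)

/-- `J₁ = J`, `J₂ = G`, `J₃ = H` (indexed by `Fin 3`). -/
def Ja (C : ComplexAlmostContactMetric g ι) (i : ι) (a : Fin 3) (x : N) :
    TangentSpace 𝓘(ℝ, E) x →L[ℝ] TangentSpace 𝓘(ℝ, E) x :=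
  ![cplxJ x, C.G i x, C.H i x] a

end ComplexAlmostContactMetric

variable (E N) in
/-- An indefinite complex contact (metric) manifold `(N, u, v, U, V, G, H, g)`, of real dimension
`4n+2`, whose metric has index `4q` with `0 < q < n`. -/
structure IndefiniteComplexContact (n q : ℕ) (κ ι : Type*) where
  g : SemiRiemannianMetric E N
  contact : ComplexContactStructure E N n κ
  almost : ComplexAlmostContactMetric g ι
  q_pos : 0 < q
  q_lt : q < n
  index_eq : ∀ x, g.index x = 4 * q
  /-- a local contact form is `u - iv` up to a nonvanishing complex valued function -/
  contact_form : ∀ k i, ∀ x ∈ contact.O k ∩ almost.O i, ∃ c : ℂ, c ≠ 0 ∧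
    ∀ w, realCovector (contact.θ k x) w =
      c * ((almost.u i x w : ℂ) - Complex.I * (almost.v i x w : ℂ))
  σ : ι → ∀ x : N, TangentSpace 𝓘(ℝ, E) x →L[ℝ] ℝ
  σ_smooth : ∀ i, ContMDiffOn 𝓘(ℝ, E) (𝓘(ℝ, E).prod 𝓘(ℝ, E →L[ℝ] ℝ)) ∞
    (fun x => TotalSpace.mk' (E →L[ℝ] ℝ) x (σ i x)) (almost.O i)
  /-- `du(X, Y) = g(X, GY) + (σ ∧ v)(X, Y)` -/
  du_eq : ∀ i, ∀ W ⊆ almost.O i, IsOpen W → ∀ X Y, SmoothFieldOn X W → SmoothFieldOn Y W →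
    ∀ x ∈ W, extDer (almost.u i) X Y x =
      g.val x (X x) (almost.G i x (Y x)) + wedge (σ i x) (almost.v i x) (X x) (Y x)
  /-- `dv(X, Y) = g(X, HY) - (σ ∧ u)(X, Y)` -/
  dv_eq : ∀ i, ∀ W ⊆ almost.O i, IsOpen W → ∀ X Y, SmoothFieldOn X W → SmoothFieldOn Y W →
    ∀ x ∈ W, extDer (almost.v i) X Y x =
      g.val x (X x) (almost.H i x (Y x)) - wedge (σ i x) (almost.u i x) (X x) (Y x)

namespace IndefiniteComplexContact

variable {n q : ℕ} {κ ι : Type*}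

/-- The tensor
`S(X, Y) = [G, G](X, Y) + 2g(X, GY)U - 2g(X, HY)V + 2(v(Y)HX - v(X)HY) + σ(GY)HX - σ(GX)HY
+ σ(X)GHY - σ(Y)GHX`. -/
def tensorS (C : IndefiniteComplexContact E N n q κ ι) (i : ι)
    (X Y : ∀ x : N, TangentSpace 𝓘(ℝ, E) x) (x : N) : TangentSpace 𝓘(ℝ, E) x :=
  let G := C.almost.G i x
  let H := C.almost.H i x
  let U := C.almost.U i x
  let V := C.almost.V i x
  let v := C.almost.v i x
  let σ := C.σ i x
  nijenhuis (C.almost.G i) X Y x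
    + (2 * C.g.val x (X x) (G (Y x))) • U - (2 * C.g.val x (X x) (H (Y x))) • V
    + (2 : ℝ) • (v (Y x) • H (X x) - v (X x) • H (Y x))
    + σ (G (Y x)) • H (X x) - σ (G (X x)) • H (Y x)
    + σ (X x) • G (H (Y x)) - σ (Y x) • G (H (X x))

/-- The tensor
`T(X, Y) = [H, H](X, Y) - 2g(X, GY)U + 2g(X, HY)V + 2(u(Y)GX - u(X)GY) + σ(HX)GY - σ(HY)GX
+ σ(X)GHY - σ(Y)GHX`. -/
def tensorT (C : IndefiniteComplexContact E N n q κ ι) (i : ι)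
    (X Y : ∀ x : N, TangentSpace 𝓘(ℝ, E) x) (x : N) : TangentSpace 𝓘(ℝ, E) x :=
  let G := C.almost.G i x
  let H := C.almost.H i x
  let U := C.almost.U i x
  let V := C.almost.V i x
  let u := C.almost.u i x
  let σ := C.σ i x
  nijenhuis (C.almost.H i) X Y x
    - (2 * C.g.val x (X x) (G (Y x))) • U + (2 * C.g.val x (X x) (H (Y x))) • V
    + (2 : ℝ) • (u (Y x) • G (X x) - u (X x) • G (Y x))
    + σ (H (X x)) • G (Y x) - σ (H (Y x)) • G (X x)
    + σ (X x) • G (H (Y x)) - σ (Y x) • G (H (X x))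

/-- Normality: `S(X, Y) = T(X, Y) = 0` for all sections `X`, `Y` of the horizontal subbundle
`{u = v = 0}`, and `S(U, X) = T(V, X) = 0` for all `X`. -/
structure IsNormal (C : IndefiniteComplexContact E N n q κ ι) : Prop where
  horizontal : ∀ i, ∀ W ⊆ C.almost.O i, IsOpen W → ∀ X Y,
    SmoothFieldOn X W → SmoothFieldOn Y W →
    (∀ x ∈ W, C.almost.u i x (X x) = 0 ∧ C.almost.v i x (X x) = 0) →
    (∀ x ∈ W, C.almost.u i x (Y x) = 0 ∧ C.almost.v i x (Y x) = 0) →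
    ∀ x ∈ W, C.tensorS i X Y x = 0 ∧ C.tensorT i X Y x = 0
  vertical : ∀ i, ∀ W ⊆ C.almost.O i, IsOpen W → ∀ X, SmoothFieldOn X W →
    ∀ x ∈ W, C.tensorS i (C.almost.U i) X x = 0 ∧ C.tensorT i (C.almost.V i) X x = 0

end IndefiniteComplexContact

variable {n q r : ℕ} {κ ι : Type*}
  {F : Type*} [NormedAddCommGroup F] [NormedSpace ℝ F]
  {M : Type*} [TopologicalSpace M] [ChartedSpace F M]

/-- A null submanifold (with its chosen screen bundles) is screen transversal anti-invariant:
`span {U, V} ⊆ S(TM^⊥)`, `J_a Rad TM ⊆ S(TM^⊥)` and `J_a S(TM) ⊆ S(TM^⊥)` for `a = 1, 2, 3`. -/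
structure IsScreenTransversalAntiInvariant (C : IndefiniteComplexContact E N n q κ ι)
    {f : M → N} (B : NullBundles F C.g f r) : Prop where
  vertical : ∀ i p, f p ∈ C.almost.O i →
    Submodule.span ℝ {C.almost.U i (f p), C.almost.V i (f p)} ≤ B.screenTr p
  rad : ∀ i p, f p ∈ C.almost.O i → ∀ a : Fin 3,
    (radSub F C.g f p).map (C.almost.Ja i a (f p)).toLinearMap ≤ B.screenTr p
  screen : ∀ i p, f p ∈ C.almost.O i → ∀ a : Fin 3,
    (B.screen p).map (C.almost.Ja i a (f p)).toLinearMap ≤ B.screenTr p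

/-- `∇^s_X J_a ξ` has no component in `J_a S(TM)`, for all `X` tangent to `M` and all (local)
sections `ξ` of `Rad TM`. As `J_a S(TM)` is a nondegenerate subbundle of `S(TM^⊥)`, the component
is taken in the orthogonal decomposition `S(TM^⊥) = J_a S(TM) ⊥ (J_a S(TM))^⊥`, and it vanishes iff
the vector lies in the second summand. -/
def NoScreenComponent [FiniteDimensional ℂ E] (C : IndefiniteComplexContact E N n q κ ι)
    {f : M → N} (B : NullBundles F C.g f r)
    (D : CovariantDerivative 𝓘(ℝ, E) E (TangentSpace 𝓘(ℝ, E) : N → Type _)) (a : Fin 3) : Prop :=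
  ∀ i, ∀ W ⊆ f ⁻¹' C.almost.O i, IsOpen W → ∀ ξ : ∀ p : M, TangentSpace 𝓘(ℝ, E) (f p),
    SmoothAlongOn (F := F) f ξ W → (∀ p ∈ W, ξ p ∈ radSub F C.g f p) →
    ∀ p ∈ W, ∀ X : TangentSpace 𝓘(ℝ, F) p,
      B.screenTrConn D (fun p => C.almost.Ja i a (f p) (ξ p)) p X ∈
        C.g.perp ((B.screen p).map (C.almost.Ja i a (f p)).toLinearMap)

end Complex

end NullGeom

end

/-!
Both sides are equivalent to one condition: `g(∇̄_X ξ, Z) = 0` for all sections `ξ` of `Rad TM`, all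
tangent `X` and all `Z` in the screen distribution.

For the induced connection (`NullBundles.isMetricConnection_iff`): since `∇̄` is metric, the
deviation `(∇_X g)(Y, Z)` comes only from the `ltr(TM)`-components of `∇̄_X Y` and `∇̄_X Z`, which
are seen only by the radical parts of `Z` and `Y`, so that it equals
`g(∇̄_X Y, Z_r) + g(∇̄_X Z, Y_r)`. Extending the radical parts to sections of `Rad TM`, which are
orthogonal to `TM`, moves the derivative onto them: the terms with two radical vectors cancel, and
those with a radical vector and a screen vector are the ones in the condition.

For the screen transversal connection (`IsScreenTransversalAntiInvariant.noScreenComponent_iff`):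
`g(∇^s_X J_a ξ, J_a Z) = g((∇̄_X J_a) ξ, J_a Z) + g(J_a ∇̄_X ξ, J_a Z)`, and `J_a` is isometric on
vectors annihilated by `u` and `v`, to which all of `TM` belongs as `U` and `V` lie in `S(TM^⊥)`.
What is left is that `(∇̄_X J_a) ξ` is orthogonal to `J_a Z`
(`IndefiniteComplexContact.val_nablaEndo_Ja`). On horizontal vectors, i.e. those annihilated by `u`
and `v`, and up to vertical vectors, `∇̄_X G = σ(X) H`, `∇̄_X H = -σ(X) G` and `∇̄_X J = 0`; as
`J TM` is orthogonal to `TM`, the claim follows.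

The formulas for `∇̄G` and `∇̄H` are two instances of `IsContactPair.val_nablaEndo`, a variant of
the computation of `∇J` on almost Hermitian manifolds: put
`B(X, Y, Z) = g((∇̄_X φ) Y, Z) - σ(X) g(ψ Y, Z)`. It is skew in `Y, Z`, satisfies
`B(X, φY, Z) = B(X, Y, φZ)`, has vanishing cyclic sum because the fundamental 2-form of `φ` is
`dα - σ ∧ β` (`IsContactPair.nablaEndo_cyclic`), and normality prescribes the Nijenhuis tensor;
together these force `B = 0`. Finally `J = -GH` on horizontal vectors gives `∇̄J = 0`.

Vector fields along the immersion are differentiated by `pullbackConn`, for which the product rules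
with the metric and with endomorphism fields are obtained by expansion in a frame of the ambient
tangent bundle.
-/

noncomputable section

namespace NullGeom

/-! ### Connections along a map -/

section PullbackConnection

variable {E : Type*} [NormedAddCommGroup E] [NormedSpace ℝ E]
  {N : Type*} [TopologicalSpace N] [ChartedSpace E N]
  {F : Type*} [NormedAddCommGroup F] [NormedSpace ℝ F]
  {M : Type*} [TopologicalSpace M] [ChartedSpace F M]

theorem mvfderiv_congr {A : Type*} [NormedAddCommGroup A] [NormedSpace ℝ A] {c c' : M → A} {p : M}
    (h : c =ᶠ[𝓝 p] c') : mvfderiv 𝓘(ℝ, F) c p = mvfderiv 𝓘(ℝ, F) c' p := by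
  unfold mvfderiv
  rw [h.mfderiv_eq]
  rfl

theorem mvfderiv_fun_sum {κ : Type*} {A : Type*} [NormedAddCommGroup A] [NormedSpace ℝ A]
    (s : Finset κ) {c : κ → M → A} {p : M}
    (h : ∀ k ∈ s, MDifferentiableAt 𝓘(ℝ, F) 𝓘(ℝ, A) (c k) p) :
    MDifferentiableAt 𝓘(ℝ, F) 𝓘(ℝ, A) (fun q => ∑ k ∈ s, c k q) p ∧
    mvfderiv 𝓘(ℝ, F) (fun q => ∑ k ∈ s, c k q) p = ∑ k ∈ s, mvfderiv 𝓘(ℝ, F) (c k) p := by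
  classical
  induction s using Finset.induction_on with
  | empty => simpa using ⟨mdifferentiableAt_const, mvfderiv_const 0⟩
  | insert a s ha ih =>
    obtain ⟨h1, h2⟩ := ih fun k hk => h k (Finset.mem_insert_of_mem hk)
    have h3 := h a (Finset.mem_insert_self a s)
    simp only [Finset.sum_insert ha]
    exact ⟨h3.add h1, by rw [mvfderiv_fun_add h3 h1, h2]⟩

variable [IsManifold 𝓘(ℝ, E) ∞ N]

/-- The vector field `Y` of `N` is differentiable at `x`. -/
abbrev DiffFieldAt (Y : ∀ x : N, TangentSpace 𝓘(ℝ, E) x) (x : N) : Prop :=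
  MDifferentiableAt 𝓘(ℝ, E) (𝓘(ℝ, E).prod 𝓘(ℝ, E)) (fun y => TotalSpace.mk' E y (Y y)) x

/-- The vector field `Y` along `f : M → N` is differentiable at `p`. -/
abbrev DiffAlongAt (f : M → N) (Y : ∀ p : M, TangentSpace 𝓘(ℝ, E) (f p)) (p : M) : Prop :=
  MDifferentiableAt 𝓘(ℝ, F) (𝓘(ℝ, E).prod 𝓘(ℝ, E))
    (fun q => (⟨f q, Y q⟩ : TotalSpace E (TangentSpace 𝓘(ℝ, E) : N → Type _))) p

/-- The coordinates of a tangent vector in the trivialization of `TN` around `x₀`. -/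
def vecCoord (x₀ y : N) (v : TangentSpace 𝓘(ℝ, E) y) : E :=
  (trivializationAt E (TangentSpace 𝓘(ℝ, E) : N → Type _) x₀ ⟨y, v⟩).2

/-- The inverse of `vecCoord x₀ y`, as a continuous linear map. -/
def vecOfCoord (x₀ y : N) : E →L[ℝ] TangentSpace 𝓘(ℝ, E) y :=
  (trivializationAt E (TangentSpace 𝓘(ℝ, E) : N → Type _) x₀).symmL ℝ y

theorem vecOfCoord_apply {x₀ y : N}
    (hy : y ∈ (trivializationAt E (TangentSpace 𝓘(ℝ, E) : N → Type _) x₀).baseSet) (w : E) :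
    vecOfCoord x₀ y w = (trivializationAt E (TangentSpace 𝓘(ℝ, E) : N → Type _) x₀).symm y w :=
  (trivializationAt E (TangentSpace 𝓘(ℝ, E) : N → Type _) x₀).symmL_apply hy w

theorem vecOfCoord_vecCoord (x : N) (v : TangentSpace 𝓘(ℝ, E) x) :
    vecOfCoord x x (vecCoord x x v) = v := by
  rw [vecOfCoord_apply (FiberBundle.mem_baseSet_trivializationAt' x)]
  exact (trivializationAt E (TangentSpace 𝓘(ℝ, E) : N → Type _) x).symm_apply_apply_mk
    (FiberBundle.mem_baseSet_trivializationAt' x) v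

variable (E) in
theorem eventually_isLinearMap_vecCoord (x : N) :
    ∀ᶠ y in 𝓝 x, IsLinearMap ℝ (vecCoord (E := E) x y) ∧
      (∀ w : E, vecCoord x y (vecOfCoord x y w) = w) ∧
      ∀ v : TangentSpace 𝓘(ℝ, E) x,
        FiberBundle.extend E v y = vecOfCoord x y (vecCoord x x v) := by
  set t := trivializationAt E (TangentSpace 𝓘(ℝ, E) : N → Type _) x with ht
  filter_upwards [t.open_baseSet.mem_nhds (FiberBundle.mem_baseSet_trivializationAt' x)] with y hy
  refine ⟨t.linear ℝ hy, fun w => ?_, fun v => ?_⟩ <;> rw [vecOfCoord_apply hy]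
  · exact congrArg Prod.snd (t.apply_mk_symm hy w)
  · rfl

theorem DiffAlongAt.mdifferentiableAt_vecCoord {f : M → N}
    {Y : ∀ p : M, TangentSpace 𝓘(ℝ, E) (f p)} {p : M}
    (hY : DiffAlongAt (F := F) f Y p) :
    MDifferentiableAt 𝓘(ℝ, F) 𝓘(ℝ, E) (fun q => vecCoord (f p) (f q) (Y q)) p :=
  ((mdifferentiableAt_totalSpace 𝓘(ℝ, E)
    (fun q => (⟨f q, Y q⟩ : TotalSpace E (TangentSpace 𝓘(ℝ, E) : N → Type _)))).1 hY).2

theorem DiffFieldAt.mdifferentiableAt_vecCoord {Y : ∀ x : N, TangentSpace 𝓘(ℝ, E) x} {x : N}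
    (hY : DiffFieldAt Y x) :
    MDifferentiableAt 𝓘(ℝ, E) 𝓘(ℝ, E) (fun y => vecCoord x y (Y y)) x :=
  ((mdifferentiableAt_totalSpace 𝓘(ℝ, E) (fun y => TotalSpace.mk' E y (Y y))).1 hY).2

theorem pullbackConn_eq (D : CovariantDerivative 𝓘(ℝ, E) E (TangentSpace 𝓘(ℝ, E) : N → Type _))
    (f : M → N) (Y : ∀ p : M, TangentSpace 𝓘(ℝ, E) (f p)) (p : M) (X : TangentSpace 𝓘(ℝ, F) p) :
    pullbackConn D f Y p X =
      vecOfCoord (f p) (f p) (mvfderiv 𝓘(ℝ, F) (fun q => vecCoord (f p) (f q) (Y q)) p X)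
      + D (FiberBundle.extend E (Y p)) (f p) (mfderiv 𝓘(ℝ, F) 𝓘(ℝ, E) f p X) := by
  rw [vecOfCoord_apply (FiberBundle.mem_baseSet_trivializationAt' (f p))]
  rfl

theorem pullbackConn_congr
    (D : CovariantDerivative 𝓘(ℝ, E) E (TangentSpace 𝓘(ℝ, E) : N → Type _))
    {f : M → N} {Y Z : ∀ p : M, TangentSpace 𝓘(ℝ, E) (f p)} {p : M} (h : ∀ᶠ q in 𝓝 p, Y q = Z q)
    (X : TangentSpace 𝓘(ℝ, F) p) : pullbackConn D f Y p X = pullbackConn D f Z p X := by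
  have h' : (fun q => vecCoord (f p) (f q) (Y q)) =ᶠ[𝓝 p]
      fun q => vecCoord (f p) (f q) (Z q) := h.mono fun q hq => by simp only [hq]
  rw [pullbackConn_eq, pullbackConn_eq, mvfderiv_congr h', h.self_of_nhds]

variable (D : CovariantDerivative 𝓘(ℝ, E) E (TangentSpace 𝓘(ℝ, E) : N → Type _))

theorem isLinearMap_conn_extend (x : N) (u : TangentSpace 𝓘(ℝ, E) x) :
    IsLinearMap ℝ fun v : TangentSpace 𝓘(ℝ, E) x => D (FiberBundle.extend E v) x u := by
  have hb := eventually_isLinearMap_vecCoord E x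
  have hd : ∀ v : TangentSpace 𝓘(ℝ, E) x, DiffFieldAt (FiberBundle.extend E v) x := fun v =>
    FiberBundle.mdifferentiableAt_extend 𝓘(ℝ, E) E v
  have hl : IsLinearMap ℝ (vecCoord (E := E) x x) := hb.self_of_nhds.1
  refine ⟨fun v w => ?_, fun c v => ?_⟩
  · have h : ∀ᶠ y in 𝓝 x, FiberBundle.extend E (v + w) y =
        (FiberBundle.extend E v + FiberBundle.extend E w) y := hb.mono fun y hy => by
      simp only [Pi.add_apply, hy.2.2, hl.map_add, map_add]
    rw [D.isCovariantDerivativeOnUniv.congr_of_eventuallyEq (hd _)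
      (mdifferentiableAt_add_section (hd v) (hd w)) Filter.univ_mem h,
      D.isCovariantDerivativeOnUniv.add (hd v) (hd w)]
    rfl
  · have h : ∀ᶠ y in 𝓝 x, FiberBundle.extend E (c • v) y =
        (c • FiberBundle.extend E v) y := hb.mono fun y hy => by
      simp only [Pi.smul_apply, hy.2.2, hl.map_smul, map_smul]
    rw [D.isCovariantDerivativeOnUniv.congr_of_eventuallyEq (hd _)
      (MDifferentiableAt.smul_const_section (hd v)) Filter.univ_mem h,
      D.isCovariantDerivativeOnUniv.smul_const c (hd v)]
    rfl

variable [FiniteDimensional ℝ E]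

/-- A linear connection is the flat connection of a trivialization plus its Christoffel tensor. -/
theorem conn_eq_vecOfCoord_mvfderiv_add {w : ∀ x : N, TangentSpace 𝓘(ℝ, E) x} {x : N}
    (hw : DiffFieldAt w x) (v : TangentSpace 𝓘(ℝ, E) x) :
    D w x v = vecOfCoord x x (mvfderiv 𝓘(ℝ, E) (fun y => vecCoord x y (w y)) x v)
      + D (FiberBundle.extend E (w x)) x v := by
  let Φ : (∀ x : N, TangentSpace 𝓘(ℝ, E) x) → TangentSpace 𝓘(ℝ, E) x := fun w =>
    D w x v - vecOfCoord x x (mvfderiv 𝓘(ℝ, E) (fun y => vecCoord x y (w y)) x v)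
  have hb := eventually_isLinearMap_vecCoord E x
  have hΦ : TensorialAt 𝓘(ℝ, E) E Φ x := by
    refine ⟨fun {c σ} hc hσ => ?_, fun {σ σ'} hσ hσ' => ?_⟩
    · have h1 := D.isCovariantDerivativeOnUniv.leibniz hσ hc (mem_univ x)
      have h2 : (fun y => vecCoord x y ((c • σ) y)) =ᶠ[𝓝 x] fun y => c y • vecCoord x y (σ y) :=
        hb.mono fun y hy => hy.1.map_smul _ _
      have h3 : mvfderiv 𝓘(ℝ, E) (fun y => vecCoord x y ((c • σ) y)) x v =
          c x • mvfderiv 𝓘(ℝ, E) (fun y => vecCoord x y (σ y)) x v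
          + mvfderiv 𝓘(ℝ, E) c x v • vecCoord x x (σ x) := by
        rw [mvfderiv_congr h2, mvfderiv_fun_smul hc (DiffFieldAt.mdifferentiableAt_vecCoord hσ)]
        rfl
      simp only [Φ, h1, h3, map_add, map_smul, vecOfCoord_vecCoord]
      simp only [FunLike.coe_add, FunLike.coe_smul, Pi.add_apply, Pi.smul_apply,
        ContinuousLinearMap.smulRight_apply]
      module
    · have h1 := D.isCovariantDerivativeOnUniv.add hσ hσ' (mem_univ x)
      have h2 : (fun y => vecCoord x y ((σ + σ') y)) =ᶠ[𝓝 x]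
          fun y => vecCoord x y (σ y) + vecCoord x y (σ' y) :=
        hb.mono fun y hy => hy.1.map_add _ _
      have h3 : mvfderiv 𝓘(ℝ, E) (fun y => vecCoord x y ((σ + σ') y)) x v =
          mvfderiv 𝓘(ℝ, E) (fun y => vecCoord x y (σ y)) x v
          + mvfderiv 𝓘(ℝ, E) (fun y => vecCoord x y (σ' y)) x v := by
        rw [mvfderiv_congr h2,
          mvfderiv_fun_add (DiffFieldAt.mdifferentiableAt_vecCoord hσ)
            (DiffFieldAt.mdifferentiableAt_vecCoord hσ')]
        rfl
      simp only [Φ, h1, h3, map_add]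
      simp only [FunLike.coe_add, Pi.add_apply]
      abel
  have h0 : (fun y => vecCoord x y (FiberBundle.extend E (w x) y)) =ᶠ[𝓝 x]
      fun _ => vecCoord x x (w x) := hb.mono fun y hy => by
    simp only [hy.2.2, hy.2.1]
  have h0' : mvfderiv 𝓘(ℝ, E) (fun y => vecCoord x y (FiberBundle.extend E (w x) y)) x v = 0 := by
    rw [mvfderiv_congr h0, mvfderiv_const]
    rfl
  have h := hΦ.pointwise hw (FiberBundle.mdifferentiableAt_extend 𝓘(ℝ, E) E (w x)) (by simp)
  simp only [Φ, h0', map_zero, sub_zero, sub_eq_iff_eq_add] at h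
  rw [h, add_comm]

/-- Leibniz rule and chain rule for the pull-back connection, for vector fields along `f` of the
form `∑ c_k (w_k ∘ f)`. -/
theorem pullbackConn_sum_smul {κ : Type*} (s : Finset κ) {f : M → N} {p : M} {c : κ → M → ℝ}
    {w : κ → ∀ x : N, TangentSpace 𝓘(ℝ, E) x}
    (hf : MDifferentiableAt 𝓘(ℝ, F) 𝓘(ℝ, E) f p)
    (hc : ∀ k ∈ s, MDifferentiableAt 𝓘(ℝ, F) 𝓘(ℝ, ℝ) (c k) p)
    (hw : ∀ k ∈ s, DiffFieldAt (w k) (f p)) (X : TangentSpace 𝓘(ℝ, F) p) :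
    pullbackConn D f (fun q => ∑ k ∈ s, c k q • w k (f q)) p X =
      ∑ k ∈ s, (mvfderiv 𝓘(ℝ, F) (c k) p X • w k (f p)
        + c k p • D (w k) (f p) (mfderiv 𝓘(ℝ, F) 𝓘(ℝ, E) f p X)) := by
  set dX := mfderiv 𝓘(ℝ, F) 𝓘(ℝ, E) f p X with hdX
  have hb := eventually_isLinearMap_vecCoord E (f p)
  -- the coordinates of the sum, and their derivative
  have h1 : (fun q => vecCoord (f p) (f q) (∑ k ∈ s, c k q • w k (f q))) =ᶠ[𝓝 p]
      fun q => ∑ k ∈ s, c k q • vecCoord (f p) (f q) (w k (f q)) := by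
    filter_upwards [hf.continuousAt.eventually hb] with q hq
    have := map_sum hq.1.mk' (fun k => c k q • w k (f q)) s
    simpa only [IsLinearMap.mk'_apply, hq.1.map_smul] using this
  have h2 : ∀ k ∈ s, MDifferentiableAt 𝓘(ℝ, F) 𝓘(ℝ, E)
      (fun q => vecCoord (f p) (f q) (w k (f q))) p := fun k hk =>
    MDifferentiableAt.comp (g := fun y => vecCoord (f p) y (w k y)) p
      (hw k hk).mdifferentiableAt_vecCoord hf
  have h3 : ∀ k ∈ s, mvfderiv 𝓘(ℝ, F) (fun q => c k q • vecCoord (f p) (f q) (w k (f q))) p X =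
      c k p • mvfderiv 𝓘(ℝ, E) (fun y => vecCoord (f p) y (w k y)) (f p) dX
      + mvfderiv 𝓘(ℝ, F) (c k) p X • vecCoord (f p) (f p) (w k (f p)) := fun k hk => by
    rw [mvfderiv_fun_smul (hc k hk) (h2 k hk)]
    have : mvfderiv 𝓘(ℝ, F) (fun q => vecCoord (f p) (f q) (w k (f q))) p X =
      mvfderiv 𝓘(ℝ, E) (fun y => vecCoord (f p) y (w k y)) (f p) dX :=
      mfderiv_comp_apply p (hw k hk).mdifferentiableAt_vecCoord hf X
    rw [← this]
    rfl
  have h4 : mvfderiv 𝓘(ℝ, F) (fun q => vecCoord (f p) (f q) (∑ k ∈ s, c k q • w k (f q))) p X =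
      ∑ k ∈ s, (c k p • mvfderiv 𝓘(ℝ, E) (fun y => vecCoord (f p) y (w k y)) (f p) dX
      + mvfderiv 𝓘(ℝ, F) (c k) p X • vecCoord (f p) (f p) (w k (f p))) := by
    rw [mvfderiv_congr h1, (mvfderiv_fun_sum s
        (c := fun k q => c k q • vecCoord (f p) (f q) (w k (f q)))
        fun k hk => (hc k hk).smul (h2 k hk)).2,
      ← Finset.sum_congr rfl h3]
    exact sum_apply _ _ _
  have h5 := map_sum (isLinearMap_conn_extend D (f p) dX).mk' (fun k => c k p • w k (f p)) s
  simp only [IsLinearMap.mk'_apply, (isLinearMap_conn_extend D (f p) dX).map_smul] at h5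
  rw [pullbackConn_eq, h4, ← hdX, h5, map_sum, ← Finset.sum_add_distrib]
  refine Finset.sum_congr rfl fun k hk => ?_
  rw [conn_eq_vecOfCoord_mvfderiv_add D (hw k hk) dX, map_add, map_smul, map_smul,
    vecOfCoord_vecCoord]
  module

/-- A vector field along `f` that is differentiable at `p` is, near `p`, a combination
`∑ c_k (w_k ∘ f)` of a frame of `TN`. -/
theorem DiffAlongAt.exists_eventually_eq_sum {f : M → N}
    {Y : ∀ p : M, TangentSpace 𝓘(ℝ, E) (f p)} {p : M}
    (hf : MDifferentiableAt 𝓘(ℝ, F) 𝓘(ℝ, E) f p) (hY : DiffAlongAt (F := F) f Y p) :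
    ∃ (m : ℕ) (c : Fin m → M → ℝ) (w : Fin m → ∀ x : N, TangentSpace 𝓘(ℝ, E) x),
      (∀ k, MDifferentiableAt 𝓘(ℝ, F) 𝓘(ℝ, ℝ) (c k) p) ∧ (∀ k, DiffFieldAt (w k) (f p)) ∧
      ∀ᶠ q in 𝓝 p, Y q = ∑ k, c k q • w k (f q) := by
  let b := Module.finBasis ℝ E
  let t := trivializationAt E (TangentSpace 𝓘(ℝ, E) : N → Type _) (f p)
  have hp : f p ∈ t.baseSet := FiberBundle.mem_baseSet_trivializationAt' (f p)
  refine ⟨_, fun k q => (LinearMap.toContinuousLinearMap (b.coord k))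
    (vecCoord (f p) (f q) (Y q)), t.localFrame b, fun k => ?_, fun k => ?_, ?_⟩
  · exact (ContinuousLinearMap.mdifferentiableAt _).comp p hY.mdifferentiableAt_vecCoord
  · exact (contMDiffAt_localFrame_of_mem 1 _ b k hp).mdifferentiableAt (by simp)
  · filter_upwards [hf.continuousAt.eventually (t.open_baseSet.mem_nhds hp)] with q hq
    have h1 := (t.basisAt b hq).sum_repr (Y q)
    rw [← h1]
    refine Finset.sum_congr rfl fun k _ => ?_
    rw [t.localFrame_apply_of_mem_baseSet b hq, h1]
    congr 1

end PullbackConnection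

/-! ### Product rules along a map and derivatives of endomorphism fields -/

section PullbackProductRules

variable {E : Type*} [NormedAddCommGroup E] [NormedSpace ℝ E]
  {N : Type*} [TopologicalSpace N] [ChartedSpace E N] [IsManifold 𝓘(ℝ, E) ∞ N]
  {F : Type*} [NormedAddCommGroup F] [NormedSpace ℝ F]
  {M : Type*} [TopologicalSpace M] [ChartedSpace F M]

theorem SemiRiemannianMetric.mdifferentiableAt_val (g : SemiRiemannianMetric E N)
    {Y Z : ∀ x : N, TangentSpace 𝓘(ℝ, E) x} {x : N} (hY : DiffFieldAt Y x)
    (hZ : DiffFieldAt Z x) :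
    MDifferentiableAt 𝓘(ℝ, E) 𝓘(ℝ, ℝ) (fun y => g.val y (Y y) (Z y)) x := by
  have h1 := (g.smooth x).mdifferentiableAt (by simp)
  have : MDifferentiableAt 𝓘(ℝ, E) (𝓘(ℝ, E).prod 𝓘(ℝ, ℝ))
      (fun y => TotalSpace.mk' ℝ (E := Bundle.Trivial N ℝ) y (g.val y (Y y) (Z y))) x :=
    MDifferentiableAt.clm_bundle_apply₂ (F₁ := E) (F₂ := E) h1 hY hZ
  rw [mdifferentiableAt_totalSpace] at this
  simpa using this.2

variable {D : CovariantDerivative 𝓘(ℝ, E) E (TangentSpace 𝓘(ℝ, E) : N → Type _)}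

/-- The endomorphism field `K` of `TN` is differentiable at `x`. -/
abbrev DiffEndoAt (K : ∀ x : N, TangentSpace 𝓘(ℝ, E) x →L[ℝ] TangentSpace 𝓘(ℝ, E) x)
    (x : N) : Prop :=
  MDifferentiableAt 𝓘(ℝ, E) (𝓘(ℝ, E).prod 𝓘(ℝ, E →L[ℝ] E))
    (fun x => TotalSpace.mk' (E →L[ℝ] E) x (K x)) x

theorem DiffEndoAt.apply {K : ∀ x : N, TangentSpace 𝓘(ℝ, E) x →L[ℝ] TangentSpace 𝓘(ℝ, E) x}
    {x : N} (hK : DiffEndoAt K x) {Y : ∀ x : N, TangentSpace 𝓘(ℝ, E) x} (hY : DiffFieldAt Y x) :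
    DiffFieldAt (fun y => K y (Y y)) x :=
  MDifferentiableAt.clm_bundle_apply (F₁ := E) (F₂ := E) hK hY

variable (D) in
/-- The covariant derivative `(∇_v K) w` of an endomorphism field `K`, computed with an arbitrary
extension of `w`. -/
def nablaEndo (K : ∀ x : N, TangentSpace 𝓘(ℝ, E) x →L[ℝ] TangentSpace 𝓘(ℝ, E) x) (x : N)
    (v w : TangentSpace 𝓘(ℝ, E) x) : TangentSpace 𝓘(ℝ, E) x :=
  D (fun y => K y (FiberBundle.extend E w y)) x v - K x (D (FiberBundle.extend E w) x v)

variable (D) in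
theorem tensorialAt_nablaEndo
    {K : ∀ x : N, TangentSpace 𝓘(ℝ, E) x →L[ℝ] TangentSpace 𝓘(ℝ, E) x} {x : N}
    (hK : DiffEndoAt K x) (v : TangentSpace 𝓘(ℝ, E) x) :
    TensorialAt 𝓘(ℝ, E) E (fun Y : ∀ x : N, TangentSpace 𝓘(ℝ, E) x =>
      D (fun y => K y (Y y)) x v - K x (D Y x v)) x := by
  refine ⟨fun {c σ} hc hσ => ?_, fun {σ σ'} hσ hσ' => ?_⟩
  · have h1 := D.isCovariantDerivativeOnUniv.leibniz hσ hc (mem_univ x)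
    have h2 := D.isCovariantDerivativeOnUniv.leibniz (hK.apply hσ) hc (mem_univ x)
    have h3 : (fun y => K y ((c • σ) y)) = c • fun y => K y (σ y) := by
      funext y; simp
    rw [h3, h1, h2]
    simp only [FunLike.coe_add, FunLike.coe_smul, Pi.add_apply, Pi.smul_apply,
        ContinuousLinearMap.smulRight_apply, map_add, map_smul]
    module
  · have h1 := D.isCovariantDerivativeOnUniv.add hσ hσ' (mem_univ x)
    have h2 := D.isCovariantDerivativeOnUniv.add (hK.apply hσ) (hK.apply hσ') (mem_univ x)
    have h3 : (fun y => K y ((σ + σ') y)) = (fun y => K y (σ y)) + fun y => K y (σ' y) := by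
      funext y; simp
    rw [h3, h1, h2]
    simp only [FunLike.coe_add, Pi.add_apply, map_add]
    abel

variable [FiniteDimensional ℝ E]

/-- The pull-back of a metric connection is metric. -/
theorem SemiRiemannianMetric.IsLeviCivita.mvfderiv_val_pullback {g : SemiRiemannianMetric E N}
    (hD : g.IsLeviCivita D) {f : M → N} {Y Z : ∀ p : M, TangentSpace 𝓘(ℝ, E) (f p)} {p : M}
    (hf : MDifferentiableAt 𝓘(ℝ, F) 𝓘(ℝ, E) f p) (hY : DiffAlongAt (F := F) f Y p)
    (hZ : DiffAlongAt (F := F) f Z p) (X : TangentSpace 𝓘(ℝ, F) p) :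
    mvfderiv 𝓘(ℝ, F) (fun q => g.val (f q) (Y q) (Z q)) p X =
      g.val (f p) (pullbackConn D f Y p X) (Z p) + g.val (f p) (Y p) (pullbackConn D f Z p X) := by
  obtain ⟨m, c, w, hc, hw, hY'⟩ := hY.exists_eventually_eq_sum hf
  obtain ⟨l, d, z, hd, hz, hZ'⟩ := hZ.exists_eventually_eq_sum hf
  have h1 : (fun q => g.val (f q) (Y q) (Z q)) =ᶠ[𝓝 p]
      fun q => ∑ i, ∑ j, (c i q * d j q) * g.val (f q) (w i (f q)) (z j (f q)) := by
    filter_upwards [hY', hZ'] with q hq hq'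
    simp only [hq, hq', map_sum, map_smul, FunLike.coe_smul, Pi.smul_apply, smul_eq_mul, sum_apply,
      Finset.mul_sum]
    rw [Finset.sum_comm]
    refine Finset.sum_congr rfl fun i _ => Finset.sum_congr rfl fun j _ => by ring
  have hg : ∀ i j, MDifferentiableAt 𝓘(ℝ, F) 𝓘(ℝ, ℝ)
      (fun q => g.val (f q) (w i (f q)) (z j (f q))) p := fun i j =>
    MDifferentiableAt.comp (g := fun y => g.val y (w i y) (z j y)) p
      (g.mdifferentiableAt_val (hw i) (hz j)) hf
  have hcd : ∀ i j, MDifferentiableAt 𝓘(ℝ, F) 𝓘(ℝ, ℝ) (fun q => c i q * d j q) p := fun i j =>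
    (hc i).mul (hd j)
  have ht : ∀ i j, MDifferentiableAt 𝓘(ℝ, F) 𝓘(ℝ, ℝ)
      (fun q => (c i q * d j q) * g.val (f q) (w i (f q)) (z j (f q))) p := fun i j =>
    (hcd i j).mul (hg i j)
  have h2 : ∀ i j, mvfderiv 𝓘(ℝ, F)
      (fun q => (c i q * d j q) * g.val (f q) (w i (f q)) (z j (f q))) p X =
      (c i p * d j p) *
        (g.val (f p) (D (w i) (f p) (mfderiv 𝓘(ℝ, F) 𝓘(ℝ, E) f p X)) (z j (f p))
          + g.val (f p) (w i (f p)) (D (z j) (f p) (mfderiv 𝓘(ℝ, F) 𝓘(ℝ, E) f p X)))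
        + g.val (f p) (w i (f p)) (z j (f p)) *
          (c i p * mvfderiv 𝓘(ℝ, F) (d j) p X + d j p * mvfderiv 𝓘(ℝ, F) (c i) p X) :=
      fun i j => by
    rw [mvfderiv_fun_mul (hcd i j) (hg i j), mvfderiv_fun_mul (hc i) (hd j),
      ← hD.metric _ _ _ _ (hw i) (hz j)]
    have : mvfderiv 𝓘(ℝ, F) (fun q => g.val (f q) (w i (f q)) (z j (f q))) p X =
      mvfderiv 𝓘(ℝ, E) (fun y => g.val y (w i y) (z j y)) (f p)
        (mfderiv 𝓘(ℝ, F) 𝓘(ℝ, E) f p X) :=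
      mfderiv_comp_apply p (g.mdifferentiableAt_val (hw i) (hz j)) hf X
    rw [← this]
    rfl
  have h3 : mvfderiv 𝓘(ℝ, F) (fun q => g.val (f q) (Y q) (Z q)) p X =
      ∑ i, ∑ j, mvfderiv 𝓘(ℝ, F)
        (fun q => (c i q * d j q) * g.val (f q) (w i (f q)) (z j (f q))) p X := by
    rw [mvfderiv_congr h1, (mvfderiv_fun_sum Finset.univ
      (c := fun i q => ∑ j, (c i q * d j q) * g.val (f q) (w i (f q)) (z j (f q)))
      fun i _ => (mvfderiv_fun_sum Finset.univ fun j _ => ht i j).1).2, sum_apply]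
    refine Finset.sum_congr rfl fun i _ => ?_
    rw [(mvfderiv_fun_sum Finset.univ fun j _ => ht i j).2, sum_apply]
  rw [h3, pullbackConn_congr D hY', pullbackConn_congr D hZ',
    pullbackConn_sum_smul D _ hf (fun k _ => hc k) (fun k _ => hw k),
    pullbackConn_sum_smul D _ hf (fun k _ => hd k) (fun k _ => hz k),
    hY'.self_of_nhds, hZ'.self_of_nhds]
  simp only [h2, map_sum, map_smul, map_add, FunLike.coe_smul, Pi.smul_apply, smul_eq_mul,
    sum_apply, FunLike.coe_add, Pi.add_apply, Finset.mul_sum]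
  rw [Finset.sum_comm (s := Finset.univ (α := Fin l))]
  simp only [← Finset.sum_add_distrib]
  rw [Finset.sum_comm (s := Finset.univ (α := Fin l)), ← Finset.sum_add_distrib]
  refine Finset.sum_congr rfl fun i _ => ?_
  rw [← Finset.sum_add_distrib]
  refine Finset.sum_congr rfl fun j _ => by ring

theorem nablaEndo_eq {K : ∀ x : N, TangentSpace 𝓘(ℝ, E) x →L[ℝ] TangentSpace 𝓘(ℝ, E) x} {x : N}
    (hK : DiffEndoAt K x) {Y : ∀ x : N, TangentSpace 𝓘(ℝ, E) x} (hY : DiffFieldAt Y x)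
    (v : TangentSpace 𝓘(ℝ, E) x) :
    nablaEndo D K x v (Y x) = D (fun y => K y (Y y)) x v - K x (D Y x v) :=
  (tensorialAt_nablaEndo D hK v).pointwise (FiberBundle.mdifferentiableAt_extend 𝓘(ℝ, E) E (Y x))
    hY (by simp)

theorem isLinearMap_nablaEndo
    {K : ∀ x : N, TangentSpace 𝓘(ℝ, E) x →L[ℝ] TangentSpace 𝓘(ℝ, E) x} {x : N}
    (hK : DiffEndoAt K x) (v : TangentSpace 𝓘(ℝ, E) x) : IsLinearMap ℝ (nablaEndo D K x v) :=
  (TensorialAt.mkHom _ x (tensorialAt_nablaEndo D hK v)).isLinear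

/-- Leibniz rule for the pull-back connection and an endomorphism field:
`∇_X (K Y) = (∇_{df X} K) Y + K ∇_X Y`. -/
theorem pullbackConn_endo {K : ∀ x : N, TangentSpace 𝓘(ℝ, E) x →L[ℝ] TangentSpace 𝓘(ℝ, E) x}
    {f : M → N} {Y : ∀ p : M, TangentSpace 𝓘(ℝ, E) (f p)} {p : M} (hK : DiffEndoAt K (f p))
    (hf : MDifferentiableAt 𝓘(ℝ, F) 𝓘(ℝ, E) f p) (hY : DiffAlongAt (F := F) f Y p)
    (X : TangentSpace 𝓘(ℝ, F) p) :
    pullbackConn D f (fun q => K (f q) (Y q)) p X =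
      nablaEndo D K (f p) (mfderiv 𝓘(ℝ, F) 𝓘(ℝ, E) f p X) (Y p)
      + K (f p) (pullbackConn D f Y p X) := by
  obtain ⟨m, c, w, hc, hw, hY'⟩ := hY.exists_eventually_eq_sum hf
  have h1 : ∀ᶠ q in 𝓝 p, K (f q) (Y q) = ∑ k, c k q • K (f q) (w k (f q)) := by
    filter_upwards [hY'] with q hq
    simp [hq]
  rw [pullbackConn_congr D h1, pullbackConn_congr D hY',
    pullbackConn_sum_smul D _ hf (fun k _ => hc k) (fun k _ => hw k),
    pullbackConn_sum_smul D (w := fun k y => K y (w k y)) _ hf (fun k _ => hc k)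
      (fun k _ => hK.apply (hw k)), hY'.self_of_nhds]
  have h2 := map_sum (isLinearMap_nablaEndo (D := D) hK (mfderiv 𝓘(ℝ, F) 𝓘(ℝ, E) f p X)).mk'
    (fun k => c k p • w k (f p)) Finset.univ
  simp only [IsLinearMap.mk'_apply, (isLinearMap_nablaEndo hK _).map_smul] at h2
  rw [h2, map_sum, ← Finset.sum_add_distrib]
  refine Finset.sum_congr rfl fun k _ => ?_
  rw [nablaEndo_eq hK (hw k), map_add, map_smul, map_smul]
  module

end PullbackProductRules

/-! ### Smooth endomorphism fields and the complex structure -/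

section SmoothEndo

variable {E : Type*} [NormedAddCommGroup E] [NormedSpace ℝ E]
  {N : Type*} [TopologicalSpace N] [ChartedSpace E N] [IsManifold 𝓘(ℝ, E) ∞ N]

/-- The endomorphism field `K` of `TN` is smooth at `x`. -/
abbrev SmoothEndoAt (K : ∀ x : N, TangentSpace 𝓘(ℝ, E) x →L[ℝ] TangentSpace 𝓘(ℝ, E) x)
    (x : N) : Prop :=
  ContMDiffAt 𝓘(ℝ, E) (𝓘(ℝ, E).prod 𝓘(ℝ, E →L[ℝ] E)) ∞
    (fun x => TotalSpace.mk' (E →L[ℝ] E) x (K x)) x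

theorem SmoothEndoAt.comp {K L : ∀ x : N, TangentSpace 𝓘(ℝ, E) x →L[ℝ] TangentSpace 𝓘(ℝ, E) x}
    {x₀ : N} (hK : SmoothEndoAt K x₀) (hL : SmoothEndoAt L x₀) :
    SmoothEndoAt (fun x => (K x).comp (L x)) x₀ := by
  have hK' := ((contMDiffAt_hom_bundle _).1 hK).2
  have hL' := ((contMDiffAt_hom_bundle _).1 hL).2
  refine (contMDiffAt_hom_bundle _).2 ⟨contMDiffAt_id, ?_⟩
  refine (hK'.clm_comp hL').congr_of_eventuallyEq ?_
  let t := trivializationAt E (TangentSpace 𝓘(ℝ, E) : N → Type _) x₀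
  filter_upwards [t.open_baseSet.mem_nhds (FiberBundle.mem_baseSet_trivializationAt' x₀)] with x hx
  ext w
  simp only [ContinuousLinearMap.inCoordinates, ContinuousLinearMap.comp_apply]
  have : ∀ v, t.symmL ℝ x (t.continuousLinearMapAt ℝ x v) = v :=
    t.symmL_continuousLinearMapAt hx
  rw [this]

theorem SmoothEndoAt.diffEndoAt
    {K : ∀ x : N, TangentSpace 𝓘(ℝ, E) x →L[ℝ] TangentSpace 𝓘(ℝ, E) x} {x : N}
    (hK : SmoothEndoAt K x) : DiffEndoAt K x :=
  hK.mdifferentiableAt (by simp)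

theorem SmoothFieldOn.endo_apply
    {K : ∀ x : N, TangentSpace 𝓘(ℝ, E) x →L[ℝ] TangentSpace 𝓘(ℝ, E) x} {W : Set N}
    (hK : ∀ x ∈ W, SmoothEndoAt K x) {Y : ∀ x : N, TangentSpace 𝓘(ℝ, E) x}
    (hY : SmoothFieldOn Y W) : SmoothFieldOn (fun x => K x (Y x)) W :=
  fun x hx => ContMDiffWithinAt.clm_bundle_apply (F₁ := E) (F₂ := E)
    (hK x hx).contMDiffWithinAt (hY x hx)

end SmoothEndo

section ComplexStructure

variable {E : Type*} [NormedAddCommGroup E] [NormedSpace ℂ E]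
  {N : Type*} [TopologicalSpace N] [ChartedSpace E N]

theorem cplxJ_cplxJ (x : N) (v : TangentSpace 𝓘(ℝ, E) x) : cplxJ x (cplxJ x v) = -v := by
  have h : ∀ w : E, Complex.I • (Complex.I • w) = -w := fun w => by
    rw [smul_smul, Complex.I_mul_I, neg_one_smul]
  exact h v

variable [IsManifold 𝓘(ℂ, E) ω N]

/-- The coordinate changes of a complex manifold have complex linear derivatives. -/
theorem tangentCoordChange_I_smul {x y z : N} (hx : z ∈ (extChartAt 𝓘(ℝ, E) x).source)
    (hy : z ∈ (extChartAt 𝓘(ℝ, E) y).source) (v : E) :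
    tangentCoordChange 𝓘(ℝ, E) x y z (Complex.I • v) =
      Complex.I • tangentCoordChange 𝓘(ℝ, E) x y z v := by
  have h1 := hasFDerivWithinAt_tangentCoordChange (I := 𝓘(ℝ, E)) (x := x) (y := y) (z := z)
    ⟨hx, hy⟩
  have h2 := (hasFDerivWithinAt_tangentCoordChange (I := 𝓘(ℂ, E)) (x := x) (y := y) (z := z)
    ⟨hx, hy⟩).restrictScalars ℝ
  have h3 : tangentCoordChange 𝓘(ℝ, E) x y z =
      (tangentCoordChange 𝓘(ℂ, E) x y z).restrictScalars ℝ := by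
    simp only [modelWithCornersSelf_coe, range_id] at h1 h2
    exact (hasFDerivWithinAt_univ.1 h1).unique (hasFDerivWithinAt_univ.1 h2)
  rw [h3]
  exact map_smul (tangentCoordChange 𝓘(ℂ, E) x y z) Complex.I v

theorem smoothEndoAt_cplxJ (x₀ : N) : SmoothEndoAt (E := E) (N := N) cplxJ x₀ := by
  refine (contMDiffAt_hom_bundle _).2 ⟨contMDiffAt_id, ?_⟩
  refine (contMDiffAt_const (c := ((Complex.I • ContinuousLinearMap.id ℂ E).restrictScalars ℝ
    : E →L[ℝ] E))).congr_of_eventuallyEq ?_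
  filter_upwards [(chartAt E x₀).open_source.mem_nhds (mem_chart_source E x₀)] with x hx
  ext w
  simp only [ContinuousLinearMap.inCoordinates, ContinuousLinearMap.comp_apply]
  rw [TangentBundle.continuousLinearMapAt_trivializationAt_eq_core hx,
    TangentBundle.symmL_trivializationAt_eq_core hx]
  have h1 := tangentCoordChange_I_smul (E := E) (x := x) (y := x₀) (z := x)
    (mem_extChartAt_source x) (by rwa [extChartAt_source])
    (tangentCoordChange 𝓘(ℝ, E) x₀ x x w)
  have h2 := tangentCoordChange_comp (I := 𝓘(ℝ, E)) (w := x₀) (x := x) (y := x₀) (z := x) (v := w)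
    ⟨⟨by rwa [extChartAt_source], mem_extChartAt_source x⟩, by rwa [extChartAt_source]⟩
  rw [h2, tangentCoordChange_self (by rwa [extChartAt_source])] at h1
  exact h1

end ComplexStructure

/-! ### The covariant derivative of an endomorphism field compatible with a 1-form -/

section ContactPair

variable {E : Type*} [NormedAddCommGroup E] [NormedSpace ℝ E]
  {N : Type*} [TopologicalSpace N] [ChartedSpace E N] [IsManifold 𝓘(ℝ, E) ∞ N]

/-- `Y` is a smooth vector field on `W` that is annihilated by the 1-forms `α` and `β`. -/
structure IsHorizontalFieldOn (α β : ∀ x : N, TangentSpace 𝓘(ℝ, E) x →L[ℝ] ℝ)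
    (Y : ∀ x : N, TangentSpace 𝓘(ℝ, E) x) (W : Set N) : Prop where
  smooth : SmoothFieldOn Y W
  left : ∀ x ∈ W, α x (Y x) = 0
  right : ∀ x ∈ W, β x (Y x) = 0

theorem IsHorizontalFieldOn.mono {α β : ∀ x : N, TangentSpace 𝓘(ℝ, E) x →L[ℝ] ℝ}
    {Y : ∀ x : N, TangentSpace 𝓘(ℝ, E) x} {W W' : Set N} (h : IsHorizontalFieldOn α β Y W)
    (hW : W' ⊆ W) : IsHorizontalFieldOn α β Y W' :=
  ⟨ContMDiffOn.mono h.smooth hW, fun x hx => h.left x (hW hx), fun x hx => h.right x (hW hx)⟩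

/-- The first order structure which determines `∇φ` in horizontal directions, on an open set `O`:
skew endomorphism fields `φ`, `ψ`, such that `φ` is a complex structure on the horizontal
distribution `ker α ∩ ker β` and anticommutes with `ψ` there, `φ` and `ψ` are given on horizontal
vectors by `dα` and `dβ`, and the Nijenhuis tensor of `φ` on horizontal vectors is expressed through
the 1-form `σ`. A complex contact metric structure gives two of them, `(u, v, G, H)` and
`(v, -u, H, -G)`. -/
structure IsContactPair (g : SemiRiemannianMetric E N) (O : Set N)
    (α β σ : ∀ x : N, TangentSpace 𝓘(ℝ, E) x →L[ℝ] ℝ)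
    (φ ψ : ∀ x : N, TangentSpace 𝓘(ℝ, E) x →L[ℝ] TangentSpace 𝓘(ℝ, E) x) : Prop where
  smooth : ∀ x ∈ O, SmoothEndoAt φ x
  skew_left : ∀ x ∈ O, ∀ v w, g.val x (φ x v) w = - g.val x v (φ x w)
  skew_right : ∀ x ∈ O, ∀ v w, g.val x (ψ x v) w = - g.val x v (ψ x w)
  maps_horizontal : ∀ x ∈ O, ∀ v, α x v = 0 → β x v = 0 → α x (φ x v) = 0 ∧ β x (φ x v) = 0
  sq : ∀ x ∈ O, ∀ v, α x v = 0 → β x v = 0 → φ x (φ x v) = -v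
  anticomm : ∀ x ∈ O, ∀ v, α x v = 0 → β x v = 0 → ψ x (φ x v) = - φ x (ψ x v)
  exists_horizontal : ∀ x ∈ O, ∀ v, α x v = 0 → β x v = 0 → ∃ W ⊆ O, IsOpen W ∧ x ∈ W ∧
    ∃ Y, IsHorizontalFieldOn α β Y W ∧ Y x = v
  extDer_left : ∀ W ⊆ O, IsOpen W → ∀ X Y, SmoothFieldOn X W → SmoothFieldOn Y W →
    ∀ x ∈ W, extDer α X Y x = g.val x (X x) (φ x (Y x)) + wedge (σ x) (β x) (X x) (Y x)
  bracket_right : ∀ W ⊆ O, IsOpen W → ∀ X Y, IsHorizontalFieldOn α β X W →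
    IsHorizontalFieldOn α β Y W →
    ∀ x ∈ W, β x (mlieBracket 𝓘(ℝ, E) X Y x) = -2 * g.val x (X x) (ψ x (Y x))
  nijenhuis_eq : ∀ W ⊆ O, IsOpen W → ∀ X Y, IsHorizontalFieldOn α β X W →
    IsHorizontalFieldOn α β Y W → ∀ x ∈ W, ∀ w, α x w = 0 → β x w = 0 →
    g.val x (nijenhuis φ X Y x) w =
      σ x (φ x (X x)) * g.val x (ψ x (Y x)) w - σ x (φ x (Y x)) * g.val x (ψ x (X x)) w
      - σ x (X x) * g.val x (φ x (ψ x (Y x))) w + σ x (Y x) * g.val x (φ x (ψ x (X x))) w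

theorem SmoothFieldOn.diffFieldAt {Y : ∀ x : N, TangentSpace 𝓘(ℝ, E) x} {W : Set N}
    (hY : SmoothFieldOn Y W) (hW : IsOpen W) {x : N} (hx : x ∈ W) : DiffFieldAt Y x :=
  (hY.contMDiffAt (hW.mem_nhds hx)).mdifferentiableAt (by simp)

theorem SmoothFieldOn.mlieBracket [CompleteSpace E] {X Y : ∀ x : N, TangentSpace 𝓘(ℝ, E) x}
    {W : Set N} (hX : SmoothFieldOn X W) (hY : SmoothFieldOn Y W) (hW : IsOpen W) :
    SmoothFieldOn (mlieBracket 𝓘(ℝ, E) X Y) W := fun x hx => by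
  have : IsManifold 𝓘(ℝ, E) ((⊤ : ℕ∞) + 1 : WithTop ℕ∞) N := by
    simpa using (inferInstance : IsManifold 𝓘(ℝ, E) ∞ N)
  have : IsManifold 𝓘(ℝ, E) (minSmoothness ℝ 2) N := by
    rw [minSmoothness_of_isRCLikeNormedField]; infer_instance
  exact (ContMDiffAt.mlieBracket_vectorField (m := ⊤) (n := ⊤)
    (hX.contMDiffAt (hW.mem_nhds hx)) (hY.contMDiffAt (hW.mem_nhds hx))
    (by simp [minSmoothness_of_isRCLikeNormedField])).contMDiffWithinAt

/-- The Jacobi identity in cyclic form. -/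
theorem mlieBracket_cyclic [CompleteSpace E] {X Y Z : ∀ x : N, TangentSpace 𝓘(ℝ, E) x} {W : Set N}
    (hX : SmoothFieldOn X W) (hY : SmoothFieldOn Y W) (hZ : SmoothFieldOn Z W) (hW : IsOpen W)
    {x : N} (hx : x ∈ W) :
    mlieBracket 𝓘(ℝ, E) (mlieBracket 𝓘(ℝ, E) X Y) Z x
      + mlieBracket 𝓘(ℝ, E) (mlieBracket 𝓘(ℝ, E) Y Z) X x
      + mlieBracket 𝓘(ℝ, E) (mlieBracket 𝓘(ℝ, E) Z X) Y x = 0 := by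
  have h2 : ∀ {Y : ∀ x : N, TangentSpace 𝓘(ℝ, E) x}, SmoothFieldOn Y W →
      ContMDiffAt 𝓘(ℝ, E) (𝓘(ℝ, E).prod 𝓘(ℝ, E)) (minSmoothness ℝ 2)
        (fun x => (TotalSpace.mk' E x (Y x))) x := fun h =>
    (h.contMDiffAt (hW.mem_nhds hx)).of_le (by
      rw [minSmoothness_of_isRCLikeNormedField]; exact ENat.LEInfty.out)
  have : IsManifold 𝓘(ℝ, E) (minSmoothness ℝ 3) N := by
    rw [minSmoothness_of_isRCLikeNormedField]; infer_instance
  have h := leibniz_identity_mlieBracket_apply (h2 hX) (h2 hY) (h2 hZ)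
  have h3 : mlieBracket 𝓘(ℝ, E) Y (mlieBracket 𝓘(ℝ, E) X Z) x =
      mlieBracket 𝓘(ℝ, E) (mlieBracket 𝓘(ℝ, E) Z X) Y x := by
    rw [mlieBracket_swap_apply, mlieBracket_swap (V := X) (W := Z)]
    have := mlieBracket_const_smul_left (c := (-1 : ℝ)) (W := Y)
      ((hZ.mlieBracket hX hW).diffFieldAt hW hx)
    rw [neg_one_smul, neg_one_smul] at this
    rw [this, neg_neg]
  rw [mlieBracket_swap_apply (V := mlieBracket 𝓘(ℝ, E) Y Z), h, h3]
  abel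

theorem nijenhuis_eq_nablaEndo [FiniteDimensional ℝ E] {g : SemiRiemannianMetric E N}
    {D : CovariantDerivative 𝓘(ℝ, E) E (TangentSpace 𝓘(ℝ, E) : N → Type _)}
    (hD : g.IsLeviCivita D)
    {K : ∀ x : N, TangentSpace 𝓘(ℝ, E) x →L[ℝ] TangentSpace 𝓘(ℝ, E) x} {x : N}
    (hK : DiffEndoAt K x) {Y Z : ∀ x : N, TangentSpace 𝓘(ℝ, E) x} (hY : DiffFieldAt Y x)
    (hZ : DiffFieldAt Z x) :
    nijenhuis K Y Z x = nablaEndo D K x (K x (Y x)) (Z x) - nablaEndo D K x (K x (Z x)) (Y x)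
      + K x (nablaEndo D K x (Z x) (Y x)) - K x (nablaEndo D K x (Y x) (Z x)) := by
  have hKY := hK.apply hY
  have hKZ := hK.apply hZ
  simp only [nijenhuis, ← hD.torsion_free x _ _ hY hZ, ← hD.torsion_free x _ _ hKY hKZ,
    ← hD.torsion_free x _ _ hKY hZ, ← hD.torsion_free x _ _ hY hKZ, nablaEndo_eq hK hY,
    nablaEndo_eq hK hZ, map_sub]
  abel

namespace IsContactPair

variable {g : SemiRiemannianMetric E N} {O : Set N}
  {α β σ : ∀ x : N, TangentSpace 𝓘(ℝ, E) x →L[ℝ] ℝ}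
  {φ ψ : ∀ x : N, TangentSpace 𝓘(ℝ, E) x →L[ℝ] TangentSpace 𝓘(ℝ, E) x}

theorem bracket_left (h : IsContactPair g O α β σ φ ψ) {W : Set N} (hWO : W ⊆ O) (hW : IsOpen W)
    {X Y : ∀ x : N, TangentSpace 𝓘(ℝ, E) x} (hX : SmoothFieldOn X W)
    (hY : IsHorizontalFieldOn α β Y W) {x : N} (hx : x ∈ W) :
    g.val x (X x) (φ x (Y x)) =
      2⁻¹ * (- mvfderiv 𝓘(ℝ, E) (fun y => α y (X y)) x (Y x)
        - α x (mlieBracket 𝓘(ℝ, E) X Y x) + σ x (Y x) * β x (X x)) := by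
  have h1 := h.extDer_left W hWO hW X Y hX hY.smooth x hx
  have h2 : (fun y => α y (Y y)) =ᶠ[𝓝 x] fun _ => 0 := by
    filter_upwards [hW.mem_nhds hx] with y hy using hY.left y hy
  have h3 : mvfderiv 𝓘(ℝ, E) (fun y => α y (Y y)) x (X x) = 0 := by
    rw [mvfderiv_congr h2, mvfderiv_const]; rfl
  simp only [extDer, wedge, hY.right x hx, h3, smul_eq_mul] at h1
  linarith

/-- For horizontal fields, `g(X, φY) = -½ α([X, Y])`. -/
theorem val_eq_bracket (h : IsContactPair g O α β σ φ ψ) {W : Set N} (hWO : W ⊆ O)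
    (hW : IsOpen W) {X Y : ∀ x : N, TangentSpace 𝓘(ℝ, E) x} (hX : IsHorizontalFieldOn α β X W)
    (hY : IsHorizontalFieldOn α β Y W) {x : N} (hx : x ∈ W) :
    g.val x (X x) (φ x (Y x)) = -2⁻¹ * α x (mlieBracket 𝓘(ℝ, E) X Y x) := by
  have h1 := h.bracket_left hWO hW hX.smooth hY hx
  have h2 : (fun y => α y (X y)) =ᶠ[𝓝 x] fun _ => 0 := by
    filter_upwards [hW.mem_nhds hx] with y hy using hX.left y hy
  have h3 : mvfderiv 𝓘(ℝ, E) (fun y => α y (X y)) x (Y x) = 0 := by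
    rw [mvfderiv_congr h2, mvfderiv_const]; rfl
  rw [h1, h3, hX.right x hx]
  ring

variable {D : CovariantDerivative 𝓘(ℝ, E) E (TangentSpace 𝓘(ℝ, E) : N → Type _)}

theorem nablaEndo_skew (h : IsContactPair g O α β σ φ ψ) (hO : IsOpen O) (hD : g.IsLeviCivita D)
    {x : N} (hx : x ∈ O) (v y z : TangentSpace 𝓘(ℝ, E) x) :
    g.val x (nablaEndo D φ x v y) z = - g.val x (nablaEndo D φ x v z) y := by
  have hφ := (h.smooth x hx).diffEndoAt
  have hd : ∀ v : TangentSpace 𝓘(ℝ, E) x, DiffFieldAt (FiberBundle.extend E v) x := fun v =>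
    FiberBundle.mdifferentiableAt_extend 𝓘(ℝ, E) E v
  have h1 := hD.metric x _ _ v (hφ.apply (hd y)) (hd z)
  have h2 := hD.metric x _ _ v (hd y) (hφ.apply (hd z))
  have h3 : (fun p => g.val p (φ p (FiberBundle.extend E y p)) (FiberBundle.extend E z p))
      =ᶠ[𝓝 x] fun p => - g.val p (FiberBundle.extend E y p) (φ p (FiberBundle.extend E z p)) := by
    filter_upwards [hO.mem_nhds hx] with p hp using h.skew_left p hp _ _
  rw [mvfderiv_congr h3, mvfderiv_fun_neg, FunLike.coe_neg, Pi.neg_apply, h2] at h1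
  simp only [FiberBundle.extend_apply_self] at h1
  have h4 := h.skew_left x hx (D (FiberBundle.extend E y) x v) z
  have h5 := h.skew_left x hx y (D (FiberBundle.extend E z) x v)
  rw [g.symm _ _ y]
  simp only [nablaEndo, map_sub, FunLike.coe_sub, Pi.sub_apply]
  linarith

variable [FiniteDimensional ℝ E]

/-- `∇_v φ` anticommutes with `φ` on the horizontal distribution: differentiate `φ² = -1`. As
`φ` is skew, this is a symmetry of `g((∇_v φ) y, z)`. -/
theorem nablaEndo_comm (h : IsContactPair g O α β σ φ ψ) {x : N} (hx : x ∈ O)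
    (v y z : TangentSpace 𝓘(ℝ, E) x) (hy : α x y = 0) (hy' : β x y = 0)
    (hz : α x z = 0) (hz' : β x z = 0) :
    g.val x (nablaEndo D φ x v (φ x y)) z = g.val x (nablaEndo D φ x v y) (φ x z) := by
  have hφ := (h.smooth x hx).diffEndoAt
  obtain ⟨W, hWO, hW, hxW, Y, hY, rfl⟩ := h.exists_horizontal x hx y hy hy'
  have hY1 := hY.smooth.diffFieldAt hW hxW
  have hY2 := hφ.apply hY1
  have h3 : ∀ᶠ p in 𝓝 x, φ p (φ p (Y p)) = ((-1 : ℝ) • Y) p := by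
    filter_upwards [hW.mem_nhds hxW] with p hp
    simpa using h.sq p (hWO hp) _ (hY.left p hp) (hY.right p hp)
  have h4 := D.isCovariantDerivativeOnUniv.congr_of_eventuallyEq (hφ.apply hY2)
    (MDifferentiableAt.smul_const_section hY1) Filter.univ_mem h3
  rw [D.isCovariantDerivativeOnUniv.smul_const _ hY1] at h4
  rw [nablaEndo_eq hφ hY2, nablaEndo_eq hφ hY1]
  have h5 := h.skew_left x hx
  have h6 := h5 (D Y x v) (φ x z)
  rw [h.sq x hx z hz hz'] at h6
  simp only [h4, map_sub, map_neg, FunLike.coe_sub, Pi.sub_apply,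
    neg_one_smul, FunLike.coe_neg, Pi.neg_apply] at h6 ⊢
  rw [h5 (D (fun y => φ y (Y y)) x v) z]
  linarith

/-- The fundamental 2-form of `φ` is `dα - σ ∧ β`, so that its exterior derivative is
`σ ∧ dβ` in horizontal directions. -/
theorem nablaEndo_cyclic (h : IsContactPair g O α β σ φ ψ) (hO : IsOpen O)
    (hD : g.IsLeviCivita D) {p : N} (hp : p ∈ O)
    (x y z : TangentSpace 𝓘(ℝ, E) p) (hx : α p x = 0) (hx' : β p x = 0) (hy : α p y = 0)
    (hy' : β p y = 0) (hz : α p z = 0) (hz' : β p z = 0) :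
    g.val p (nablaEndo D φ p x y) z + g.val p (nablaEndo D φ p y z) x
      + g.val p (nablaEndo D φ p z x) y =
    σ p x * g.val p (ψ p y) z + σ p y * g.val p (ψ p z) x + σ p z * g.val p (ψ p x) y := by
  have hφ := (h.smooth p hp).diffEndoAt
  obtain ⟨W₁, hWO, hW₁, hp₁, X, hX, rfl⟩ := h.exists_horizontal p hp x hx hx'
  obtain ⟨W₂, -, hW₂, hp₂, Y, hY, rfl⟩ := h.exists_horizontal p hp y hy hy'
  obtain ⟨W₃, -, hW₃, hp₃, Z, hZ, rfl⟩ := h.exists_horizontal p hp z hz hz'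
  obtain ⟨W, hWO, hW, hpW, hX, hY, hZ⟩ : ∃ W ⊆ O, IsOpen W ∧ p ∈ W ∧
      IsHorizontalFieldOn α β X W ∧ IsHorizontalFieldOn α β Y W ∧ IsHorizontalFieldOn α β Z W :=
    ⟨W₁ ∩ (W₂ ∩ W₃), inter_subset_left.trans hWO, hW₁.inter (hW₂.inter hW₃), ⟨hp₁, hp₂, hp₃⟩,
      hX.mono inter_subset_left, hY.mono (inter_subset_right.trans inter_subset_left),
      hZ.mono (inter_subset_right.trans inter_subset_right)⟩
  -- one summand of the cyclic sum `∑ (X (g(Y, φZ)) - g([X, Y], φZ))`, evaluated with `∇` and with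
  -- `α`, `β`
  have key : ∀ {X Y Z : ∀ x : N, TangentSpace 𝓘(ℝ, E) x}, IsHorizontalFieldOn α β X W →
      IsHorizontalFieldOn α β Y W → IsHorizontalFieldOn α β Z W →
      g.val p (D Y p (X p)) (φ p (Z p)) - g.val p (nablaEndo D φ p (X p) (Y p)) (Z p)
        - g.val p (D Z p (X p)) (φ p (Y p))
        - (g.val p (D Y p (X p)) (φ p (Z p)) - g.val p (D X p (Y p)) (φ p (Z p))) =
      -2⁻¹ * mvfderiv 𝓘(ℝ, E) (fun q => α q (mlieBracket 𝓘(ℝ, E) Y Z q)) p (X p)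
        + 2⁻¹ * mvfderiv 𝓘(ℝ, E) (fun q => α q (mlieBracket 𝓘(ℝ, E) X Y q)) p (Z p)
        + 2⁻¹ * α p (mlieBracket 𝓘(ℝ, E) (mlieBracket 𝓘(ℝ, E) X Y) Z p)
        - σ p (Z p) * g.val p (ψ p (X p)) (Y p) := by
    intro X Y Z hX hY hZ
    have dX := hX.smooth.diffFieldAt hW hpW
    have dY := hY.smooth.diffFieldAt hW hpW
    have dZ := hZ.smooth.diffFieldAt hW hpW
    have h1 := hD.metric p _ _ (X p) dY (hφ.apply dZ)
    have h2 : (fun q => g.val q (Y q) (φ q (Z q))) =ᶠ[𝓝 p]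
        fun q => -2⁻¹ * α q (mlieBracket 𝓘(ℝ, E) Y Z q) := by
      filter_upwards [hW.mem_nhds hpW] with q hq using h.val_eq_bracket hWO hW hY hZ hq
    have hα : MDifferentiableAt 𝓘(ℝ, E) 𝓘(ℝ, ℝ)
        (fun q => α q (mlieBracket 𝓘(ℝ, E) Y Z q)) p := by
      have h3 := (g.mdifferentiableAt_val dY (hφ.apply dZ)).congr_of_eventuallyEq h2.symm
      have h4 : MDifferentiableAt 𝓘(ℝ, E) 𝓘(ℝ, ℝ)
          (fun q => (-2 : ℝ) * (-2⁻¹ * α q (mlieBracket 𝓘(ℝ, E) Y Z q))) p :=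
        MDifferentiableAt.mul mdifferentiableAt_const h3
      simpa [← mul_assoc] using h4
    have h3 : mvfderiv 𝓘(ℝ, E) (fun q => -2⁻¹ * α q (mlieBracket 𝓘(ℝ, E) Y Z q)) p (X p) =
        -2⁻¹ * mvfderiv 𝓘(ℝ, E) (fun q => α q (mlieBracket 𝓘(ℝ, E) Y Z q)) p (X p) := by
      rw [mvfderiv_fun_mul mdifferentiableAt_const hα, mvfderiv_const]
      simp
    have h4 := h.bracket_left hWO hW (hX.smooth.mlieBracket hY.smooth hW) hZ hpW
    have h5 := h.bracket_right W hWO hW X Y hX hY p hpW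
    have h6 := hD.torsion_free p X Y dX dY
    have h7 := nablaEndo_eq (D := D) hφ dZ (X p)
    have h8 := h.nablaEndo_skew hO hD (D := D) hp (X p) (Y p) (Z p)
    have h9 := h.skew_left p hp (Y p) (D Z p (X p))
    have h10 := h.skew_right p hp (X p) (Y p)
    have h11 : g.val p (mlieBracket 𝓘(ℝ, E) X Y p) (φ p (Z p)) =
        g.val p (D Y p (X p)) (φ p (Z p)) - g.val p (D X p (Y p)) (φ p (Z p)) := by
      rw [← h6, map_sub]
      rfl
    rw [mvfderiv_congr h2, h3, ← eq_sub_iff_add_eq.1 h7, map_add] at h1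
    rw [g.symm p _ (Y p)] at h8
    rw [g.symm p _ (D Z p (X p))] at h9
    rw [h5] at h4
    linear_combination h11 - h1 - h8 - h9 - h4 + σ p (Z p) * h10
  have k1 := key hX hY hZ
  have k2 := key hY hZ hX
  have k3 := key hZ hX hY
  have hJ := congrArg (α p) (mlieBracket_cyclic hX.smooth hY.smooth hZ.smooth hW hpW)
  simp only [map_add, map_zero] at hJ
  linarith

/-- In horizontal directions `∇_x φ = σ(x) ψ`. -/
theorem val_nablaEndo (h : IsContactPair g O α β σ φ ψ) (hO : IsOpen O)
    (hD : g.IsLeviCivita D) {p : N} (hp : p ∈ O)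
    (x y z : TangentSpace 𝓘(ℝ, E) p) (hx : α p x = 0) (hx' : β p x = 0) (hy : α p y = 0)
    (hy' : β p y = 0) (hz : α p z = 0) (hz' : β p z = 0) :
    g.val p (nablaEndo D φ p x y) z = σ p x * g.val p (ψ p y) z := by
  have hφ := (h.smooth p hp).diffEndoAt
  obtain ⟨fx, fx'⟩ := h.maps_horizontal p hp x hx hx'
  obtain ⟨fy, fy'⟩ := h.maps_horizontal p hp y hy hy'
  obtain ⟨fz, fz'⟩ := h.maps_horizontal p hp z hz hz'
  -- the cyclic identity for `x, y, z` and for `x, φy, φz`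
  have c1 := h.nablaEndo_cyclic hO hD hp x y z hx hx' hy hy' hz hz'
  have c2 := h.nablaEndo_cyclic hO hD hp x _ _ hx hx' fy fy' fz fz'
  have a1 := h.nablaEndo_comm (D := D) hp x y _ hy hy' fz fz'
  rw [h.sq p hp z hz hz', map_neg] at a1
  have a2 := h.nablaEndo_comm (D := D) hp (φ p y) z x hz hz' hx hx'
  have a3 := h.nablaEndo_skew hO hD (D := D) hp (φ p z) x (φ p y)
  have a4 := h.nablaEndo_comm (D := D) hp (φ p z) y x hy hy' hx hx'
  have a5 := h.nablaEndo_skew hO hD (D := D) hp z x y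
  -- the Nijenhuis tensor of `y, z` paired with `φx`
  obtain ⟨W₂, hWO, hW₂, hp₂, Y, hY, rfl⟩ := h.exists_horizontal p hp y hy hy'
  obtain ⟨W₃, -, hW₃, hp₃, Z, hZ, rfl⟩ := h.exists_horizontal p hp z hz hz'
  have n1 := h.nijenhuis_eq (W₂ ∩ W₃) (inter_subset_left.trans hWO) (hW₂.inter hW₃) Y Z
    (hY.mono inter_subset_left) (hZ.mono inter_subset_right) p ⟨hp₂, hp₃⟩ (φ p x) fx fx'
  rw [nijenhuis_eq_nablaEndo hD hφ (hY.smooth.diffFieldAt hW₂ hp₂)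
    (hZ.smooth.diffFieldAt hW₃ hp₃)] at n1
  have hs : ∀ v, g.val p (φ p v) (φ p x) = g.val p v x := fun v => by
    rw [h.skew_left p hp, h.sq p hp x hx hx', map_neg, neg_neg]
  simp only [map_add, map_sub, FunLike.coe_add, FunLike.coe_sub, Pi.add_apply, Pi.sub_apply,
    hs] at n1
  -- moving `φ` across `ψ`
  have p1 : g.val p (ψ p (φ p (Y p))) (φ p (Z p)) = - g.val p (ψ p (Y p)) (Z p) := by
    rw [h.anticomm p hp _ hy hy', map_neg, FunLike.coe_neg, Pi.neg_apply, h.skew_left p hp,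
      h.sq p hp _ hz hz', map_neg, neg_neg]
  have p2 : g.val p (ψ p (φ p (Z p))) x = g.val p (ψ p (Z p)) (φ p x) := by
    rw [h.anticomm p hp _ hz hz', map_neg, FunLike.coe_neg, Pi.neg_apply, h.skew_left p hp,
      neg_neg]
  have p3 : g.val p (ψ p x) (φ p (Y p)) = - g.val p (ψ p (Y p)) (φ p x) := by
    rw [h.skew_right p hp, h.anticomm p hp _ hy hy', map_neg, neg_neg, g.symm, h.skew_left p hp]
  have p4 : g.val p (ψ p x) (Y p) = - g.val p (ψ p (Y p)) x := by
    rw [h.skew_right p hp, g.symm]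
  rw [p1, p2, p3] at c2
  rw [p4] at c1
  linarith

end IsContactPair
end ContactPair

/-! ### Normal complex contact metric manifolds -/

section Horizontal

variable {E : Type*} [NormedAddCommGroup E] [NormedSpace ℝ E]
  {N : Type*} [TopologicalSpace N] [ChartedSpace E N]

theorem extDer_eq_of_eqOn_zero {α : ∀ x : N, TangentSpace 𝓘(ℝ, E) x →L[ℝ] ℝ}
    {X Y : ∀ x : N, TangentSpace 𝓘(ℝ, E) x} {W : Set N} (hW : IsOpen W)
    (hX : ∀ x ∈ W, α x (X x) = 0) (hY : ∀ x ∈ W, α x (Y x) = 0) {x : N} (hx : x ∈ W) :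
    extDer α X Y x = -2⁻¹ * α x (mlieBracket 𝓘(ℝ, E) X Y x) := by
  have h1 : (fun y => α y (X y)) =ᶠ[𝓝 x] fun _ => 0 := by
    filter_upwards [hW.mem_nhds hx] with y hy using hX y hy
  have h2 : (fun y => α y (Y y)) =ᶠ[𝓝 x] fun _ => 0 := by
    filter_upwards [hW.mem_nhds hx] with y hy using hY y hy
  simp only [extDer, mvfderiv_congr h1, mvfderiv_congr h2, mvfderiv_const, smul_eq_mul,
    FunLike.coe_zero, Pi.zero_apply]
  ring

variable [IsManifold 𝓘(ℝ, E) ∞ N]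

theorem SmoothFieldOn.contMDiffOn_form_apply {α : ∀ x : N, TangentSpace 𝓘(ℝ, E) x →L[ℝ] ℝ}
    {W : Set N} (hα : ContMDiffOn 𝓘(ℝ, E) (𝓘(ℝ, E).prod 𝓘(ℝ, E →L[ℝ] ℝ)) ∞
      (fun x => TotalSpace.mk' (E →L[ℝ] ℝ) x (α x)) W)
    {Y : ∀ x : N, TangentSpace 𝓘(ℝ, E) x} (hY : SmoothFieldOn Y W) :
    ContMDiffOn 𝓘(ℝ, E) 𝓘(ℝ, ℝ) ∞ (fun x => α x (Y x)) W := by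
  intro x hx
  have : ContMDiffWithinAt 𝓘(ℝ, E) (𝓘(ℝ, E).prod 𝓘(ℝ, ℝ)) ∞
      (fun y => TotalSpace.mk' ℝ (E := Bundle.Trivial N ℝ) y (α y (Y y))) W x :=
    ContMDiffWithinAt.clm_bundle_apply (F₁ := E) (F₂ := ℝ) (hα x hx) (hY x hx)
  rw [contMDiffWithinAt_totalSpace] at this
  simpa using this.2

end Horizontal

section ComplexContact

variable {E : Type*} [NormedAddCommGroup E] [NormedSpace ℂ E]
  {N : Type*} [TopologicalSpace N] [ChartedSpace E N] [IsManifold 𝓘(ℂ, E) ω N]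

namespace ComplexAlmostContactMetric

variable {g : SemiRiemannianMetric E N} {ι : Type*} (C : ComplexAlmostContactMetric g ι)

include C in
theorem J_skew (x : N) (v w : TangentSpace 𝓘(ℝ, E) x) :
    g.val x (cplxJ x v) w = - g.val x v (cplxJ x w) := by
  have h := C.hermitian x v (cplxJ x w)
  rw [cplxJ_cplxJ, map_neg] at h
  linarith

theorem v_apply (i : ι) (x : N) (w : TangentSpace 𝓘(ℝ, E) x) :
    C.v i x w = C.u i x (cplxJ x w) := rfl

theorem H_apply (i : ι) (x : N) (w : TangentSpace 𝓘(ℝ, E) x) :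
    C.H i x w = C.G i x (cplxJ x w) := rfl

theorem v_J (i : ι) (x : N) (w : TangentSpace 𝓘(ℝ, E) x) :
    C.v i x (cplxJ x w) = - C.u i x w := by
  rw [v_apply, cplxJ_cplxJ, map_neg]

variable {C} {i : ι} {x : N} (hx : x ∈ C.O i)
include hx

theorem J_G (w : TangentSpace 𝓘(ℝ, E) x) : cplxJ x (C.G i x w) = - C.G i x (cplxJ x w) := by
  rw [C.G_J i x hx, neg_neg]

theorem u_G (w : TangentSpace 𝓘(ℝ, E) x) : C.u i x (C.G i x w) = 0 := by
  have h := C.G_skew i x hx (C.U i x) w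
  rw [C.G_U i x hx] at h
  rw [← C.dual i x hx]
  simpa using h.symm

theorem v_G (w : TangentSpace 𝓘(ℝ, E) x) : C.v i x (C.G i x w) = 0 := by
  rw [v_apply, J_G hx, map_neg, u_G hx, neg_zero]

theorem val_V (w : TangentSpace 𝓘(ℝ, E) x) : g.val x (C.V i x) w = C.v i x w := by
  rw [V, map_neg, FunLike.coe_neg, Pi.neg_apply, C.J_skew, neg_neg, C.dual i x hx]
  rfl

theorem G_G {w : TangentSpace 𝓘(ℝ, E) x} (hu : C.u i x w = 0) (hv : C.v i x w = 0) :
    C.G i x (C.G i x w) = -w := by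
  rw [C.G_sq i x hx, ← v_apply, hu, hv]
  simp

theorem H_H (w : TangentSpace 𝓘(ℝ, E) x) : C.H i x (C.H i x w) = C.G i x (C.G i x w) := by
  rw [H_apply, H_apply, J_G hx, cplxJ_cplxJ]
  simp

theorem H_G (w : TangentSpace 𝓘(ℝ, E) x) : C.H i x (C.G i x w) = - C.G i x (C.H i x w) := by
  rw [H_apply, H_apply, J_G hx, map_neg]

theorem H_skew (v w : TangentSpace 𝓘(ℝ, E) x) :
    g.val x (C.H i x v) w = - g.val x v (C.H i x w) := by
  rw [H_apply, H_apply, C.G_skew i x hx, C.J_skew, J_G hx, map_neg, neg_neg]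

theorem v_U : C.v i x (C.U i x) = 0 := by
  have h := C.J_skew x (C.U i x) (C.U i x)
  rw [g.symm, C.dual i x hx] at h
  rw [v_apply]
  linarith

theorem u_V : C.u i x (C.V i x) = 0 := by
  rw [V, map_neg, ← v_apply, v_U hx, neg_zero]

theorem v_V : C.v i x (C.V i x) = 1 := by
  rw [V, map_neg, v_J, neg_neg, C.u_U i x hx]

theorem smoothEndoAt_G : SmoothEndoAt (C.G i) x :=
  (C.G_smooth i).contMDiffAt ((C.isOpen i).mem_nhds hx)

theorem smoothEndoAt_H : SmoothEndoAt (C.H i) x :=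
  (smoothEndoAt_G hx).comp (smoothEndoAt_cplxJ x)

/-- Every horizontal vector extends to a horizontal vector field: project any extension. -/
theorem exists_isHorizontalFieldOn [FiniteDimensional ℂ E] {w : TangentSpace 𝓘(ℝ, E) x}
    (hu : C.u i x w = 0) (hv : C.v i x w = 0) : ∃ W ⊆ C.O i, IsOpen W ∧ x ∈ W ∧
      ∃ Y, IsHorizontalFieldOn (C.u i) (C.v i) Y W ∧ Y x = w := by
  obtain ⟨W₀, hW₀, h1⟩ : ∃ W₀ ∈ 𝓝 x, SmoothFieldOn (FiberBundle.extend E w) W₀ :=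
    FiberBundle.exists_contMDiffOn_extend (k := ∞) 𝓘(ℝ, E) E w
  obtain ⟨W, hWW, hW, hxW⟩ := mem_nhds_iff.1
    (Filter.inter_mem hW₀ ((C.isOpen i).mem_nhds hx))
  have hO : W ⊆ C.O i := hWW.trans inter_subset_right
  have hY : SmoothFieldOn (FiberBundle.extend E w) W := h1.mono (hWW.trans inter_subset_left)
  have hJ : ∀ y ∈ W, SmoothEndoAt (E := E) (N := N) cplxJ y := fun y _ => smoothEndoAt_cplxJ y
  have hU : SmoothFieldOn (C.U i) W := (C.U_smooth i).mono hO
  have hV : SmoothFieldOn (C.V i) W := ContMDiffOn.neg_section (hU.endo_apply hJ)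
  have hc := hY.contMDiffOn_form_apply ((C.u_smooth i).mono hO)
  have hd := (hY.endo_apply hJ).contMDiffOn_form_apply ((C.u_smooth i).mono hO)
  refine ⟨W, hO, hW, hxW, _, ⟨(ContMDiffOn.sub_section (ContMDiffOn.sub_section hY
    (ContMDiffOn.smul_section hc hU)) (ContMDiffOn.smul_section hd hV)), fun y hy => ?_,
    fun y hy => ?_⟩, ?_⟩
  · simp [C.u_U i y (hO hy), u_V (hO hy)]
  · simp [v_U (hO hy), v_V (hO hy), ← v_apply]
  · simp [hu, ← v_apply, hv]

theorem maps_horizontal_G (w : TangentSpace 𝓘(ℝ, E) x) :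
    C.u i x (C.G i x w) = 0 ∧ C.v i x (C.G i x w) = 0 := ⟨u_G hx w, v_G hx w⟩

theorem maps_horizontal_H (w : TangentSpace 𝓘(ℝ, E) x) :
    C.u i x (C.H i x w) = 0 ∧ C.v i x (C.H i x w) = 0 := ⟨u_G hx _, v_G hx _⟩

theorem diffEndoAt_Ja (a : Fin 3) : DiffEndoAt (C.Ja i a) x := by
  fin_cases a
  · exact (smoothEndoAt_cplxJ x).diffEndoAt
  · exact (smoothEndoAt_G hx).diffEndoAt
  · exact (smoothEndoAt_H hx).diffEndoAt

/-- Each `J_a` is isometric on horizontal vectors; it suffices that one argument is horizontal. -/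
theorem val_Ja_Ja (a : Fin 3) (w : TangentSpace 𝓘(ℝ, E) x) {z : TangentSpace 𝓘(ℝ, E) x}
    (hu : C.u i x z = 0) (hv : C.v i x z = 0) :
    g.val x (C.Ja i a x w) (C.Ja i a x z) = g.val x w z := by
  have hG : ∀ w, g.val x (C.G i x w) (C.G i x z) = g.val x w z := fun w => by
    rw [C.G_skew i x hx, G_G hx hu hv, map_neg, neg_neg]
  fin_cases a
  · exact C.hermitian x w z
  · exact hG w
  · change g.val x (C.H i x w) (C.H i x z) = g.val x w z
    rw [H_skew hx, H_H hx, G_G hx hu hv, map_neg, neg_neg]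

end ComplexAlmostContactMetric

namespace IndefiniteComplexContact

open ComplexAlmostContactMetric

variable [FiniteDimensional ℂ E] {n q : ℕ} {κ ι : Type*} {C : IndefiniteComplexContact E N n q κ ι}

theorem isContactPair_G (hC : C.IsNormal) (i : ι) :
    IsContactPair C.g (C.almost.O i) (C.almost.u i) (C.almost.v i) (C.σ i) (C.almost.G i)
      (C.almost.H i) where
  smooth x hx := smoothEndoAt_G hx
  skew_left x hx := C.almost.G_skew i x hx
  skew_right x hx := H_skew hx
  maps_horizontal x hx v _ _ := maps_horizontal_G hx v
  sq x hx v := G_G hx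
  anticomm x hx v _ _ := H_G hx v
  exists_horizontal x hx v := exists_isHorizontalFieldOn hx
  extDer_left := C.du_eq i
  bracket_right W hWO hW X Y hX hY x hx := by
    have h := C.dv_eq i W hWO hW X Y hX.smooth hY.smooth x hx
    rw [extDer_eq_of_eqOn_zero hW hX.right hY.right hx, wedge, hX.left x hx, hY.left x hx] at h
    linarith
  nijenhuis_eq W hWO hW X Y hX hY x hx w hu hv := by
    have h := (hC.horizontal i W hWO hW X Y hX.smooth hY.smooth
      (fun x hx => ⟨hX.left x hx, hX.right x hx⟩) (fun x hx => ⟨hY.left x hx, hY.right x hx⟩)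
      x hx).1
    have h' := congrArg (fun t => C.g.val x t w) h
    have hU := C.almost.dual i x (hWO hx) w
    have hV := val_V (hWO hx) w
    rw [hu] at hU
    rw [hv] at hV
    simp only [tensorS, hX.right x hx, hY.right x hx, map_add, map_sub, map_smul, map_zero,
      FunLike.coe_add, FunLike.coe_sub, FunLike.coe_smul, FunLike.coe_zero, Pi.add_apply,
      Pi.sub_apply, Pi.smul_apply, Pi.zero_apply, smul_eq_mul, hU, hV] at h'
    linarith

/-- Rotating `(u, v, G, H)` by a right angle gives the pair that governs `∇H`. -/
theorem isContactPair_H (hC : C.IsNormal) (i : ι) :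
    IsContactPair C.g (C.almost.O i) (C.almost.v i) (fun x => - C.almost.u i x) (C.σ i)
      (C.almost.H i) (fun x => - C.almost.G i x) where
  smooth x hx := smoothEndoAt_H hx
  skew_left x hx := H_skew hx
  skew_right x hx v w := by simp [C.almost.G_skew i x hx]
  maps_horizontal x hx v _ _ := by
    obtain ⟨h1, h2⟩ := maps_horizontal_H hx v
    simp [h1, h2]
  sq x hx v h1 h2 := by
    rw [H_H hx, G_G hx (by simpa using h2) h1]
  anticomm x hx v _ _ := by
    simp [H_G hx]
  exists_horizontal x hx v h1 h2 := by
    obtain ⟨W, hWO, hW, hxW, Y, hY, h⟩ := exists_isHorizontalFieldOn hx (by simpa using h2) h1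
    exact ⟨W, hWO, hW, hxW, Y, ⟨hY.smooth, hY.right, fun x hx => by simp [hY.left x hx]⟩, h⟩
  extDer_left W hWO hW X Y hX hY x hx := by
    rw [C.dv_eq i W hWO hW X Y hX hY x hx]
    simp only [wedge, FunLike.coe_neg, Pi.neg_apply]
    ring
  bracket_right W hWO hW X Y hX hY x hx := by
    have h1 : ∀ x ∈ W, C.almost.u i x (X x) = 0 := fun x hx => by simpa using hX.right x hx
    have h2 : ∀ x ∈ W, C.almost.u i x (Y x) = 0 := fun x hx => by simpa using hY.right x hx
    have h := C.du_eq i W hWO hW X Y hX.smooth hY.smooth x hx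
    rw [extDer_eq_of_eqOn_zero hW h1 h2 hx, wedge, hX.left x hx, hY.left x hx] at h
    simp only [FunLike.coe_neg, Pi.neg_apply, map_neg]
    linarith
  nijenhuis_eq W hWO hW X Y hX hY x hx w hv hu := by
    have h1 : ∀ x ∈ W, C.almost.u i x (X x) = 0 := fun x hx => by simpa using hX.right x hx
    have h2 : ∀ x ∈ W, C.almost.u i x (Y x) = 0 := fun x hx => by simpa using hY.right x hx
    have h := (hC.horizontal i W hWO hW X Y hX.smooth hY.smooth
      (fun x hx => ⟨h1 x hx, hX.left x hx⟩) (fun x hx => ⟨h2 x hx, hY.left x hx⟩) x hx).2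
    have h' := congrArg (fun t => C.g.val x t w) h
    have hU := C.almost.dual i x (hWO hx) w
    have hV := val_V (hWO hx) w
    rw [FunLike.coe_neg, Pi.neg_apply, neg_eq_zero] at hu
    rw [hu] at hU
    rw [hv] at hV
    have e1 : ∀ y, C.almost.H i x (C.almost.G i x y) = - C.almost.G i x (C.almost.H i x y) :=
      fun y => H_G (hWO hx) y
    simp only [tensorT, h1 x hx, h2 x hx, map_add, map_sub, map_smul, map_zero,
      FunLike.coe_add, FunLike.coe_sub, FunLike.coe_smul, FunLike.coe_zero, Pi.add_apply,
      Pi.sub_apply, Pi.smul_apply, Pi.zero_apply, smul_eq_mul, hU, hV] at h'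
    simp only [FunLike.coe_neg, Pi.neg_apply, map_neg, e1]
    linarith

variable {D : CovariantDerivative 𝓘(ℝ, E) E (TangentSpace 𝓘(ℝ, E) : N → Type _)}
  {i : ι} {p : N}

theorem val_nablaEndo_G (hC : C.IsNormal) (hD : C.g.IsLeviCivita D) (hp : p ∈ C.almost.O i)
    {x y z : TangentSpace 𝓘(ℝ, E) p} (hx : C.almost.u i p x = 0 ∧ C.almost.v i p x = 0)
    (hy : C.almost.u i p y = 0 ∧ C.almost.v i p y = 0)
    (hz : C.almost.u i p z = 0 ∧ C.almost.v i p z = 0) :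
    C.g.val p (nablaEndo D (C.almost.G i) p x y) z = C.σ i p x * C.g.val p (C.almost.H i p y) z :=
  (isContactPair_G hC i).val_nablaEndo (C.almost.isOpen i) hD hp x y z hx.1 hx.2 hy.1 hy.2 hz.1 hz.2

theorem val_nablaEndo_H (hC : C.IsNormal) (hD : C.g.IsLeviCivita D) (hp : p ∈ C.almost.O i)
    {x y z : TangentSpace 𝓘(ℝ, E) p} (hx : C.almost.u i p x = 0 ∧ C.almost.v i p x = 0)
    (hy : C.almost.u i p y = 0 ∧ C.almost.v i p y = 0)
    (hz : C.almost.u i p z = 0 ∧ C.almost.v i p z = 0) :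
    C.g.val p (nablaEndo D (C.almost.H i) p x y) z =
      - (C.σ i p x * C.g.val p (C.almost.G i p y) z) := by
  have h := (isContactPair_H hC i).val_nablaEndo (C.almost.isOpen i) hD hp x y z hx.2
    (by simp [hx.1]) hy.2 (by simp [hy.1]) hz.2 (by simp [hz.1])
  simpa using h

/-- On horizontal vectors `J = -GH`, so that `∇J = 0` there by the formulas for `∇G` and `∇H`. -/
theorem val_nablaEndo_cplxJ (hC : C.IsNormal) (hD : C.g.IsLeviCivita D) (hp : p ∈ C.almost.O i)
    {x y z : TangentSpace 𝓘(ℝ, E) p} (hx : C.almost.u i p x = 0 ∧ C.almost.v i p x = 0)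
    (hy : C.almost.u i p y = 0 ∧ C.almost.v i p y = 0)
    (hz : C.almost.u i p z = 0 ∧ C.almost.v i p z = 0) :
    C.g.val p (nablaEndo D cplxJ p x y) z = 0 := by
  obtain ⟨W, hWO, hW, hpW, Y, hY, rfl⟩ := exists_isHorizontalFieldOn hp hy.1 hy.2
  have dG := (smoothEndoAt_G hp).diffEndoAt
  have dH := (smoothEndoAt_H hp).diffEndoAt
  have dJ : DiffEndoAt (E := E) (N := N) cplxJ p := (smoothEndoAt_cplxJ p).diffEndoAt
  have dY := hY.smooth.diffFieldAt hW hpW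
  have dHY := dH.apply dY
  have hG := val_nablaEndo_G (D := D) hC hD hp hx (maps_horizontal_H hp (Y p)) hz
  have hH := val_nablaEndo_H (D := D) hC hD hp hx hy (maps_horizontal_G hp z)
  have hJ : D (fun y => C.almost.G i y (C.almost.H i y (Y y))) p
      = D ((-1 : ℝ) • fun y => cplxJ y (Y y)) p := by
    refine D.isCovariantDerivativeOnUniv.congr_of_eventuallyEq (dG.apply dHY)
      (MDifferentiableAt.smul_const_section (dJ.apply dY)) Filter.univ_mem ?_
    filter_upwards [hW.mem_nhds hpW] with y hy
    have h1 := C.almost.v_J i y (Y y)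
    rw [hY.left y hy, neg_zero] at h1
    rw [H_apply, G_G (w := cplxJ y (Y y)) (hWO hy) (hY.right y hy) h1]
    simp
  rw [D.isCovariantDerivativeOnUniv.smul_const (-1) (dJ.apply dY)] at hJ
  rw [nablaEndo_eq dG dHY] at hG
  rw [nablaEndo_eq dH dY] at hH
  rw [nablaEndo_eq dJ dY]
  have hJ' : D (fun y => C.almost.G i y (C.almost.H i y (Y y))) p x
      = - D (fun y => cplxJ y (Y y)) p x := by
    rw [hJ]; simp
  have e1 : C.almost.G i p (C.almost.G i p z) = -z := G_G hp hz.1 hz.2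
  have e2 : C.almost.H i p (C.almost.G i p z) = cplxJ p z := by
    have h1 := C.almost.v_J i p z
    rw [hz.1, neg_zero] at h1
    rw [H_G hp, H_apply, G_G (w := cplxJ p z) hp hz.2 h1, neg_neg]
  rw [hJ'] at hG
  simp only [map_sub, map_neg, FunLike.coe_sub, FunLike.coe_neg, Pi.sub_apply, Pi.neg_apply,
    C.almost.G_skew i p hp, H_skew hp, C.almost.J_skew, e1, e2, H_H hp] at hG hH ⊢
  linarith

/-- `(∇_x J_a) y` is orthogonal to `J_a z` for horizontal `x`, `y`, `z` with `Jy ⊥ z`: it equals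
`0`, `σ(x) Hy`, `-σ(x) Gy` for `a = 1, 2, 3`, up to vertical terms. -/
theorem val_nablaEndo_Ja (hC : C.IsNormal) (hD : C.g.IsLeviCivita D) (hp : p ∈ C.almost.O i)
    {x y z : TangentSpace 𝓘(ℝ, E) p} (hx : C.almost.u i p x = 0 ∧ C.almost.v i p x = 0)
    (hy : C.almost.u i p y = 0 ∧ C.almost.v i p y = 0)
    (hz : C.almost.u i p z = 0 ∧ C.almost.v i p z = 0) (hyz : C.g.val p (cplxJ p y) z = 0)
    (a : Fin 3) :
    C.g.val p (nablaEndo D (C.almost.Ja i a) p x y) (C.almost.Ja i a p z) = 0 := by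
  have hJz : C.almost.u i p (cplxJ p z) = 0 ∧ C.almost.v i p (cplxJ p z) = 0 :=
    ⟨hz.2, by rw [v_J, hz.1, neg_zero]⟩
  fin_cases a
  · exact val_nablaEndo_cplxJ hC hD hp hx hy hJz
  · refine (val_nablaEndo_G hC hD hp hx hy (maps_horizontal_G hp z)).trans ?_
    have h := val_Ja_Ja hp 1 (cplxJ p y) hz.1 hz.2
    rw [hyz] at h
    exact mul_eq_zero_of_right _ h
  · refine (val_nablaEndo_H hC hD hp hx hy (maps_horizontal_H hp z)).trans ?_
    have h := val_Ja_Ja hp 1 y hJz.1 hJz.2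
    rw [← neg_neg (C.g.val p y _), ← C.almost.J_skew, hyz, neg_zero] at h
    exact neg_eq_zero.2 (mul_eq_zero_of_right _ h)

end IndefiniteComplexContact
end ComplexContact

/-! ### Null submanifolds and their induced connection -/

section NullSubmanifold

variable {E : Type*} [NormedAddCommGroup E] [NormedSpace ℝ E]
  {N : Type*} [TopologicalSpace N] [ChartedSpace E N]
  {F : Type*} [NormedAddCommGroup F] [NormedSpace ℝ F]
  {M : Type*} [TopologicalSpace M] [ChartedSpace F M]

theorem mfderiv_mem_tangentSub {f : M → N} (p : M) (X : TangentSpace 𝓘(ℝ, F) p) :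
    mfderiv 𝓘(ℝ, F) 𝓘(ℝ, E) f p X ∈ tangentSub (E := E) F f p := ⟨X, rfl⟩

variable [IsManifold 𝓘(ℝ, E) ∞ N]

theorem SmoothAlongOn.diffAlongAt {f : M → N} {Y : ∀ p : M, TangentSpace 𝓘(ℝ, E) (f p)}
    {W : Set M} (hY : SmoothAlongOn (F := F) f Y W) (hW : IsOpen W) {p : M} (hp : p ∈ W) :
    DiffAlongAt (F := F) f Y p :=
  (ContMDiffOn.contMDiffAt hY (hW.mem_nhds hp)).mdifferentiableAt (by simp)

theorem SmoothAlongOn.sum_const_smul {k : ℕ} {f : M → N} (hf : ContMDiff 𝓘(ℝ, F) 𝓘(ℝ, E) ∞ f)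
    {e : Fin k → ∀ p : M, TangentSpace 𝓘(ℝ, E) (f p)} {W : Set M} (hW : IsOpen W)
    (he : ∀ j, SmoothAlongOn (F := F) f (e j) W) (c : Fin k → ℝ) :
    SmoothAlongOn (F := F) f (fun p => ∑ j, c j • e j p) W := by
  intro p hp
  refine ContMDiffAt.contMDiffWithinAt (contMDiffAt_totalSpace.2 ⟨hf p, ?_⟩)
  have h1 : (fun q => vecCoord (f p) (f q) (∑ j, c j • e j q)) =ᶠ[𝓝 p]
      fun q => ∑ j, c j • vecCoord (f p) (f q) (e j q) := by
    filter_upwards [hf.continuous.continuousAt.eventually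
      (eventually_isLinearMap_vecCoord E (f p))] with q hq
    have := map_sum hq.1.mk' (fun j => c j • e j q) Finset.univ
    simpa only [IsLinearMap.mk'_apply, hq.1.map_smul] using this
  refine ContMDiffAt.congr_of_eventuallyEq (contMDiffAt_finsetSum fun j _ => ?_) h1
  exact (contMDiffAt_const (c := c j) (I' := 𝓘(ℝ, ℝ))).smul (I' := 𝓘(ℝ, E))
    (contMDiffAt_totalSpace.1 (ContMDiffOn.contMDiffAt (he j) (hW.mem_nhds hp))).2

/-- Every vector of a smooth subbundle extends to a local section of it. -/
theorem IsSmoothSubbundle.exists_section {f : M → N} (hf : ContMDiff 𝓘(ℝ, F) 𝓘(ℝ, E) ∞ f)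
    {B : ∀ p : M, Submodule ℝ (TangentSpace 𝓘(ℝ, E) (f p))} {k : ℕ}
    (hB : IsSmoothSubbundle (F := F) f B k) {p : M} {v : TangentSpace 𝓘(ℝ, E) (f p)}
    (hv : v ∈ B p) : ∃ W : Set M, IsOpen W ∧ p ∈ W ∧
      ∃ Y : ∀ q : M, TangentSpace 𝓘(ℝ, E) (f q), SmoothAlongOn (F := F) f Y W ∧
        (∀ q ∈ W, Y q ∈ B q) ∧ Y p = v := by
  obtain ⟨W, hW, hp, e, he, hs⟩ := hB p
  rw [← (hs p hp).2] at hv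
  obtain ⟨c, rfl⟩ := (Submodule.mem_span_range_iff_exists_fun ℝ).1 hv
  refine ⟨W, hW, hp, _, SmoothAlongOn.sum_const_smul hf hW he c, fun q hq => ?_, rfl⟩
  rw [← (hs q hq).2]
  exact Submodule.sum_mem _ fun j _ => Submodule.smul_mem _ _ (Submodule.subset_span ⟨j, rfl⟩)

theorem SmoothFieldOn.smoothAlongOn_mfderiv [IsManifold 𝓘(ℝ, F) ∞ M] {f : M → N}
    (hf : ContMDiff 𝓘(ℝ, F) 𝓘(ℝ, E) ∞ f) {Y : ∀ p : M, TangentSpace 𝓘(ℝ, F) p} {W : Set M}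
    (hY : SmoothFieldOn Y W) :
    SmoothAlongOn (F := F) f (fun p => mfderiv 𝓘(ℝ, F) 𝓘(ℝ, E) f p (Y p)) W :=
  ContMDiff.comp_contMDiffOn (hf.contMDiff_tangentMap (m := ∞) (by simp)) hY

variable {g : SemiRiemannianMetric E N} {f : M → N} {r : ℕ}

theorem val_eq_zero_of_mem_radSub {p : M} {v w : TangentSpace 𝓘(ℝ, E) (f p)}
    (hv : v ∈ radSub F g f p) (hw : w ∈ tangentSub F f p) : g.val (f p) v w = 0 := by
  rw [g.symm]
  exact g.mem_perp.1 hv.2 w hw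

namespace NullBundles

variable (B : NullBundles F g f r)

theorem screen_le (p : M) : B.screen p ≤ tangentSub F f p := B.screen_sup p ▸ le_sup_right

theorem val_screenTr_eq_zero {p : M} {s w : TangentSpace 𝓘(ℝ, E) (f p)} (hs : s ∈ B.screenTr p)
    (hw : w ∈ tangentSub F f p) : g.val (f p) s w = 0 := by
  rw [g.symm]
  exact g.mem_perp.1 (B.screenTr_le p hs) w hw

variable [FiniteDimensional ℝ E]
  {D : CovariantDerivative 𝓘(ℝ, E) E (TangentSpace 𝓘(ℝ, E) : N → Type _)}

/-- A section of `S(TM^⊥)` pairs with `∇^s_X W` as with `∇̄_X W`. -/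
theorem val_screenTrConn {p : M} {s : TangentSpace 𝓘(ℝ, E) (f p)} (hs : s ∈ B.screenTr p)
    (W : ∀ p : M, TangentSpace 𝓘(ℝ, E) (f p)) (X : TangentSpace 𝓘(ℝ, F) p) :
    g.val (f p) s (B.screenTrConn D W p X) = g.val (f p) s (pullbackConn D f W p X) := by
  set P := (B.screenTr p).projectionOnto _ (B.isCompl_screenTr p) with hP
  have h1 : pullbackConn D f W p X - (P (pullbackConn D f W p X) : TangentSpace 𝓘(ℝ, E) (f p)) ∈
      tangentSub F f p ⊔ B.ltr p := by
    rw [← Submodule.projectionOnto_apply_eq_zero_iff (B.isCompl_screenTr p), ← hP, map_sub,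
      sub_eq_zero, hP, Submodule.projectionOnto_apply_left]
  obtain ⟨t, ht, l, hl, h⟩ := Submodule.mem_sup.1 h1
  have h2 : g.val (f p) s (t + l) = 0 := by
    rw [map_add, B.val_screenTr_eq_zero hs ht, zero_add]
    exact g.mem_perp.1 (B.ltr_le p hl).2 s hs
  rw [h, map_sub, sub_eq_zero] at h2
  exact h2.symm

/-- The tangential part of `∇̄_X Y` pairs with a tangent vector `z_r + z_s`, `z_r` radical and `z_s`
in the screen, as `∇̄_X Y` does up to the term `g(∇̄_X Y, z_r)`, which comes from `ltr(TM)`. -/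
theorem val_inducedConn (hf : IsNullSubmanifold F g f r) (Y : ∀ p : M, TangentSpace 𝓘(ℝ, F) p)
    {p : M} (X : TangentSpace 𝓘(ℝ, F) p) {zr zs : TangentSpace 𝓘(ℝ, E) (f p)}
    (hr : zr ∈ radSub F g f p) (hs : zs ∈ B.screen p) :
    g.val (f p) (mfderiv 𝓘(ℝ, F) 𝓘(ℝ, E) f p (B.inducedConn hf D Y p X)) (zr + zs) =
      g.val (f p) (pullbackConn D f (fun q => mfderiv 𝓘(ℝ, F) 𝓘(ℝ, E) f q (Y q)) p X) zs := by
  set A := pullbackConn D f (fun q => mfderiv 𝓘(ℝ, F) 𝓘(ℝ, E) f q (Y q)) p X with hA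
  set T := mfderiv 𝓘(ℝ, F) 𝓘(ℝ, E) f p (B.inducedConn hf D Y p X) with hT
  have h1 : A - T ∈ B.tr p := by
    rw [← LinearMap.ker_linearProjOfIsCompl (hi := hf.injective p) (h := B.isCompl_tr p),
      LinearMap.mem_ker, map_sub, sub_eq_zero]
    exact (LinearMap.linearProjOfIsCompl_apply_left _ _ _ _ _).symm
  obtain ⟨l, hl, s, hs', h⟩ := Submodule.mem_sup.1 h1
  have h2 : g.val (f p) (A - T) zs = 0 := by
    rw [← h, map_add, FunLike.coe_add, Pi.add_apply,
      B.val_screenTr_eq_zero hs' (B.screen_le p hs), add_zero, g.symm]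
    exact g.mem_perp.1 (B.ltr_le p hl).1 zs hs
  have h3 : g.val (f p) T zr = 0 := by
    rw [g.symm]
    exact val_eq_zero_of_mem_radSub hr (mfderiv_mem_tangentSub p _)
  rw [map_sub, FunLike.coe_sub, Pi.sub_apply, sub_eq_zero] at h2
  rw [map_add, h3, zero_add, h2]

/-- For a section `ξ` of `Rad TM` and a tangent field `Y`, `g(∇̄_X ξ, Y) = -g(ξ, ∇̄_X Y)`. -/
theorem val_pullbackConn_rad (hD : g.IsLeviCivita D) (hf : IsNullSubmanifold F g f r)
    {W : Set M} (hW : IsOpen W) {ξ Y : ∀ p : M, TangentSpace 𝓘(ℝ, E) (f p)}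
    (hξ : SmoothAlongOn (F := F) f ξ W) (hξr : ∀ p ∈ W, ξ p ∈ radSub F g f p)
    (hY : SmoothAlongOn (F := F) f Y W) (hYt : ∀ p ∈ W, Y p ∈ tangentSub F f p)
    {p : M} (hp : p ∈ W) (X : TangentSpace 𝓘(ℝ, F) p) :
    g.val (f p) (pullbackConn D f ξ p X) (Y p)
      + g.val (f p) (ξ p) (pullbackConn D f Y p X) = 0 := by
  have h : (fun q => g.val (f q) (ξ q) (Y q)) =ᶠ[𝓝 p] fun _ => 0 := by
    filter_upwards [hW.mem_nhds hp] with q hq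
    exact val_eq_zero_of_mem_radSub (hξr q hq) (hYt q hq)
  rw [← hD.mvfderiv_val_pullback ((hf.smooth p).mdifferentiableAt (by simp))
    (hξ.diffAlongAt hW hp) (hY.diffAlongAt hW hp), mvfderiv_congr h, mvfderiv_const]
  rfl

variable [IsManifold 𝓘(ℝ, F) ∞ M]

/-- The deviation of `∇` from being metric is carried by the radical parts. -/
theorem mvfderiv_inducedMetric_sub (hD : g.IsLeviCivita D) (hf : IsNullSubmanifold F g f r)
    {W : Set M} (hW : IsOpen W) {Y Z : ∀ p : M, TangentSpace 𝓘(ℝ, F) p}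
    (hY : SmoothFieldOn Y W) (hZ : SmoothFieldOn Z W) {p : M} (hp : p ∈ W)
    (X : TangentSpace 𝓘(ℝ, F) p) {yr ys zr zs : TangentSpace 𝓘(ℝ, E) (f p)}
    (hyr : yr ∈ radSub F g f p) (hys : ys ∈ B.screen p)
    (hy : yr + ys = mfderiv 𝓘(ℝ, F) 𝓘(ℝ, E) f p (Y p))
    (hzr : zr ∈ radSub F g f p) (hzs : zs ∈ B.screen p)
    (hz : zr + zs = mfderiv 𝓘(ℝ, F) 𝓘(ℝ, E) f p (Z p)) :
    mvfderiv 𝓘(ℝ, F) (fun q => inducedMetric F g f q (Y q) (Z q)) p X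
        - inducedMetric F g f p (B.inducedConn hf D Y p X) (Z p)
        - inducedMetric F g f p (Y p) (B.inducedConn hf D Z p X) =
      g.val (f p) (pullbackConn D f (fun q => mfderiv 𝓘(ℝ, F) 𝓘(ℝ, E) f q (Y q)) p X) zr
      + g.val (f p) (pullbackConn D f (fun q => mfderiv 𝓘(ℝ, F) 𝓘(ℝ, E) f q (Z q)) p X) yr := by
  have h1 := hD.mvfderiv_val_pullback ((hf.smooth p).mdifferentiableAt (by simp))
    ((hY.smoothAlongOn_mfderiv hf.smooth).diffAlongAt hW hp)
    ((hZ.smoothAlongOn_mfderiv hf.smooth).diffAlongAt hW hp) X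
  have h2 := B.val_inducedConn (D := D) hf Y X hzr hzs
  have h3 := B.val_inducedConn (D := D) hf Z X hyr hys
  rw [hz] at h2
  rw [hy] at h3
  simp only [inducedMetric]
  rw [h1, h2, g.symm _ _ (mfderiv 𝓘(ℝ, F) 𝓘(ℝ, E) f p (B.inducedConn hf D Z p X)), h3,
    g.symm _ _ (pullbackConn D f (fun q => mfderiv 𝓘(ℝ, F) 𝓘(ℝ, E) f q (Z q)) p X), ← hz, ← hy,
    map_add, map_add]
  ring

/-- The induced connection is metric iff `∇̄_X ξ` is orthogonal to the screen distribution for all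
sections `ξ` of `Rad TM`. -/
theorem isMetricConnection_iff (hD : g.IsLeviCivita D) (hf : IsNullSubmanifold F g f r) :
    B.IsMetricConnection hf D ↔ ∀ W : Set M, IsOpen W →
      ∀ ξ : ∀ p : M, TangentSpace 𝓘(ℝ, E) (f p), SmoothAlongOn (F := F) f ξ W →
      (∀ p ∈ W, ξ p ∈ radSub F g f p) → ∀ p ∈ W, ∀ X : TangentSpace 𝓘(ℝ, F) p,
      ∀ z ∈ B.screen p, g.val (f p) (pullbackConn D f ξ p X) z = 0 := by
  constructor
  · intro h W hW ξ hξ hξr p hp X z hz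
    -- test the metric property on fields with the values `z` and `ξ p` at `p`
    obtain ⟨y₀, hy₀⟩ := B.screen_le p hz
    obtain ⟨z₀, hz₀⟩ := (hξr p hp).1
    change mfderiv 𝓘(ℝ, F) 𝓘(ℝ, E) f p y₀ = z at hy₀
    change mfderiv 𝓘(ℝ, F) 𝓘(ℝ, E) f p z₀ = ξ p at hz₀
    obtain ⟨W₁, hW₁, h1⟩ := FiberBundle.exists_contMDiffOn_extend (k := ∞) 𝓘(ℝ, F) F y₀
    obtain ⟨W₂, hW₂, h2⟩ := FiberBundle.exists_contMDiffOn_extend (k := ∞) 𝓘(ℝ, F) F z₀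
    obtain ⟨W', hWW, hW', hpW⟩ := mem_nhds_iff.1
      (Filter.inter_mem (hW.mem_nhds hp) (Filter.inter_mem hW₁ hW₂))
    have hY : SmoothFieldOn (FiberBundle.extend F y₀) W' := h1.mono fun q hq => (hWW hq).2.1
    have hZ : SmoothFieldOn (FiberBundle.extend F z₀) W' := h2.mono fun q hq => (hWW hq).2.2
    have h3 := h W' hW' _ _ hY hZ p hpW X
    rw [B.mvfderiv_inducedMetric_sub hD hf hW' hY hZ hpW X (yr := 0) (ys := z) (zr := ξ p)
      (zs := 0) (Submodule.zero_mem _) hz (by simp [hy₀]) (hξr p hp) (Submodule.zero_mem _)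
      (by simp [hz₀]), map_zero, add_zero] at h3
    have h4 := val_pullbackConn_rad hD hf hW' (hξ.mono fun q hq => (hWW hq).1)
      (fun q hq => hξr q (hWW hq).1) (hY.smoothAlongOn_mfderiv hf.smooth)
      (fun q _ => mfderiv_mem_tangentSub q _) hpW X
    rw [g.symm _ (ξ p), h3, add_zero] at h4
    simpa [hy₀] using h4
  · intro h W hW Y Z hY hZ p hp X
    have hy := mfderiv_mem_tangentSub (E := E) (f := f) p (Y p)
    have hz := mfderiv_mem_tangentSub (E := E) (f := f) p (Z p)
    rw [← B.screen_sup p] at hy hz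
    obtain ⟨yr, hyr, ys, hys, hy⟩ := Submodule.mem_sup.1 hy
    obtain ⟨zr, hzr, zs, hzs, hz⟩ := Submodule.mem_sup.1 hz
    rw [B.mvfderiv_inducedMetric_sub hD hf hW hY hZ hp X hyr hys hy hzr hzs hz]
    -- extend the radical parts of `Y p` and `Z p` to sections `η` and `ζ` of `Rad TM`
    obtain ⟨W₁, hW₁, hp₁, η, hη, hηr, rfl⟩ := hf.rad_smooth.exists_section hf.smooth hyr
    obtain ⟨W₂, hW₂, hp₂, ζ, hζ, hζr, rfl⟩ := hf.rad_smooth.exists_section hf.smooth hzr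
    have hO : IsOpen (W ∩ (W₁ ∩ W₂)) := hW.inter (hW₁.inter hW₂)
    have hpO : p ∈ W ∩ (W₁ ∩ W₂) := ⟨hp, hp₁, hp₂⟩
    have hη' : SmoothAlongOn (F := F) f η (W ∩ (W₁ ∩ W₂)) := hη.mono fun q hq => hq.2.1
    have hζ' : SmoothAlongOn (F := F) f ζ (W ∩ (W₁ ∩ W₂)) := hζ.mono fun q hq => hq.2.2
    have hηr' : ∀ q ∈ W ∩ (W₁ ∩ W₂), η q ∈ radSub F g f q := fun q hq => hηr q hq.2.1
    have hζr' : ∀ q ∈ W ∩ (W₁ ∩ W₂), ζ q ∈ radSub F g f q := fun q hq => hζr q hq.2.2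
    have h1 := val_pullbackConn_rad hD hf hO hζ' hζr'
      ((hY.smoothAlongOn_mfderiv hf.smooth).mono inter_subset_left)
      (fun q _ => mfderiv_mem_tangentSub q _) hpO X
    have h2 := val_pullbackConn_rad hD hf hO hη' hηr'
      ((hZ.smoothAlongOn_mfderiv hf.smooth).mono inter_subset_left)
      (fun q _ => mfderiv_mem_tangentSub q _) hpO X
    have h3 := val_pullbackConn_rad hD hf hO hη' hηr' hζ' (fun q hq => (hζr' q hq).1) hpO X
    rw [← hy, map_add, h _ hO ζ hζ' hζr' p hpO X ys hys, g.symm _ (ζ p)] at h1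
    rw [← hz, map_add, h _ hO η hη' hηr' p hpO X zs hzs, g.symm _ (η p)] at h2
    rw [g.symm _ (η p)] at h3
    linarith

end NullBundles
end NullSubmanifold

section AntiInvariant

variable {E : Type*} [NormedAddCommGroup E] [NormedSpace ℂ E]
  {N : Type*} [TopologicalSpace N] [ChartedSpace E N] [IsManifold 𝓘(ℂ, E) ω N]
  {F : Type*} [NormedAddCommGroup F] [NormedSpace ℝ F]
  {M : Type*} [TopologicalSpace M] [ChartedSpace F M]
  {n q r : ℕ} {κ ι : Type*} {C : IndefiniteComplexContact E N n q κ ι}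
  {D : CovariantDerivative 𝓘(ℝ, E) E (TangentSpace 𝓘(ℝ, E) : N → Type _)}
  {f : M → N} {B : NullBundles F C.g f r}

namespace IsScreenTransversalAntiInvariant

open ComplexAlmostContactMetric

theorem horizontal_of_mem_tangentSub (hB : IsScreenTransversalAntiInvariant C B) {i : ι} {p : M}
    (hp : f p ∈ C.almost.O i) {w : TangentSpace 𝓘(ℝ, E) (f p)} (hw : w ∈ tangentSub F f p) :
    C.almost.u i (f p) w = 0 ∧ C.almost.v i (f p) w = 0 := by
  rw [← C.almost.dual i _ hp, ← val_V hp]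
  exact ⟨B.val_screenTr_eq_zero (hB.vertical i p hp (Submodule.subset_span (by simp))) hw,
    B.val_screenTr_eq_zero (hB.vertical i p hp (Submodule.subset_span (by simp))) hw⟩

variable [FiniteDimensional ℂ E]

/-- For a section `ξ` of `Rad TM` and `z` in the screen,
`g(J_a z, ∇^s_X J_a ξ) = g(∇̄_X ξ, z)`. -/
theorem val_screenTrConn_Ja (hB : IsScreenTransversalAntiInvariant C B) (hC : C.IsNormal)
    (hD : C.g.IsLeviCivita D) (hf : IsNullSubmanifold F C.g f r) {i : ι} {p : M}
    (hp : f p ∈ C.almost.O i) {ξ : ∀ p : M, TangentSpace 𝓘(ℝ, E) (f p)}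
    (hξ : DiffAlongAt (F := F) f ξ p) (hξr : ξ p ∈ radSub F C.g f p)
    (X : TangentSpace 𝓘(ℝ, F) p) {z : TangentSpace 𝓘(ℝ, E) (f p)} (hz : z ∈ B.screen p)
    (a : Fin 3) :
    C.g.val (f p) (C.almost.Ja i a (f p) z)
      (B.screenTrConn D (fun p => C.almost.Ja i a (f p) (ξ p)) p X) =
      C.g.val (f p) (pullbackConn D f ξ p X) z := by
  have hzT := B.screen_le p hz
  have hzh := hB.horizontal_of_mem_tangentSub hp hzT
  have hJξ : C.g.val (f p) (cplxJ (f p) (ξ p)) z = 0 :=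
    B.val_screenTr_eq_zero (hB.rad i p hp 0 ⟨ξ p, hξr, rfl⟩) hzT
  have hJz : C.almost.Ja i a (f p) z ∈ B.screenTr p := hB.screen i p hp a ⟨z, hz, rfl⟩
  rw [B.val_screenTrConn hJz,
    pullbackConn_endo (diffEndoAt_Ja hp a) ((hf.smooth p).mdifferentiableAt (by simp)) hξ,
    map_add, C.g.symm, IndefiniteComplexContact.val_nablaEndo_Ja hC hD hp
      (hB.horizontal_of_mem_tangentSub hp (mfderiv_mem_tangentSub p X))
      (hB.horizontal_of_mem_tangentSub hp hξr.1) hzh hJξ a, zero_add, C.g.symm,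
    val_Ja_Ja hp a _ hzh.1 hzh.2]

/-- The condition on `∇^s` does not depend on `a`. -/
theorem noScreenComponent_iff (hB : IsScreenTransversalAntiInvariant C B) (hC : C.IsNormal)
    (hD : C.g.IsLeviCivita D) (hf : IsNullSubmanifold F C.g f r) (a : Fin 3) :
    NoScreenComponent C B D a ↔ ∀ W : Set M, IsOpen W →
      ∀ ξ : ∀ p : M, TangentSpace 𝓘(ℝ, E) (f p), SmoothAlongOn (F := F) f ξ W →
      (∀ p ∈ W, ξ p ∈ radSub F C.g f p) → ∀ p ∈ W, ∀ X : TangentSpace 𝓘(ℝ, F) p,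
      ∀ z ∈ B.screen p, C.g.val (f p) (pullbackConn D f ξ p X) z = 0 := by
  constructor
  · intro h W hW ξ hξ hξr p hp X z hz
    obtain ⟨i, hi⟩ := C.almost.cover (f p)
    have hO : IsOpen (W ∩ f ⁻¹' C.almost.O i) :=
      hW.inter ((C.almost.isOpen i).preimage hf.smooth.continuous)
    have h1 := h i _ inter_subset_right hO ξ (hξ.mono inter_subset_left)
      (fun q hq => hξr q hq.1) p ⟨hp, hi⟩ X
    rw [← hB.val_screenTrConn_Ja hC hD hf hi (hξ.diffAlongAt hW hp) (hξr p hp) X hz a]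
    exact C.g.mem_perp.1 h1 _ ⟨z, hz, rfl⟩
  · intro h i W hWO hW ξ hξ hξr p hp X
    refine C.g.mem_perp.2 ?_
    rintro _ ⟨z, hz, rfl⟩
    exact (hB.val_screenTrConn_Ja hC hD hf (hWO hp) (hξ.diffAlongAt hW hp) (hξr p hp) X hz
      a).trans (h W hW ξ hξ hξr p hp X z hz)

end IsScreenTransversalAntiInvariant
end AntiInvariant

end NullGeom

end

theorem mainTheorem7
    {E : Type*} [NormedAddCommGroup E] [NormedSpace ℂ E] [FiniteDimensional ℂ E]
    {N : Type*} [TopologicalSpace N] [T2Space N] [SigmaCompactSpace N] [ChartedSpace E N]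
    [IsManifold 𝓘(ℂ, E) ω N]
    {F : Type*} [NormedAddCommGroup F] [NormedSpace ℝ F] [FiniteDimensional ℝ F]
    {M : Type*} [TopologicalSpace M] [T2Space M] [SigmaCompactSpace M] [ChartedSpace F M]
    [IsManifold 𝓘(ℝ, F) ∞ M]
    {κ ι : Type*} (n q r : ℕ)
    (C : NullGeom.IndefiniteComplexContact E N n q κ ι) (hC : C.IsNormal)
    (D : CovariantDerivative 𝓘(ℝ, E) E (TangentSpace 𝓘(ℝ, E) : N → Type _))
    (hD : C.g.IsLeviCivita D)
    (f : M → N) (hf : NullGeom.IsNullSubmanifold F C.g f r)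
    (B : NullGeom.NullBundles F C.g f r)
    (hB : NullGeom.IsScreenTransversalAntiInvariant C B) (a : Fin 3) :
    B.IsMetricConnection hf D ↔ NullGeom.NoScreenComponent C B D a :=
  (B.isMetricConnection_iff hD hf).trans (hB.noScreenComponent_iff hC hD hf a).symm
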